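/- Let $\lambda>0$, $\phi>0$, $\gamma\ge 0$, $0<\rho\le 1$, $0<\mu\le 1$ and, if $\gamma\neq 0$, assume $0<\mu\lceil\gamma\rceil/\gamma-r\rho<1$ for all $r=0,\dots,\lceil\gamma\rceil$. Write $$E^{\gamma}_{\rho,\mu}(x)=\sum_{k\ge 0}\frac{(\gamma)_k}{\Gamma(\rho k+\mu)}\frac{x^k}{k!},\qquad (\gamma)_k=\gamma(\gamma+1)\cdots(\gamma+k-1),$$ $$\mathbf{E}^{\gamma}_{\rho,\mu,\omega,0^+}f(t)=\int_0^t (t-y)^{\mu-1}E^{\gamma}_{\rho,\mu}(\omega(t-y)^\rho)f(y)\,dy,\qquad \mathbf{E}^{0}_{\rho,0,\omega,0^+}f=f,$$ and let ${}^C\mathcal{D}^{\gamma,\mu}_{\rho,\omega,0^+}f=\mathbf{E}^{-\gamma}_{\rho,1-\mu,\omega,0^+}f'$ be the regularized Hilfer--Prabhakar derivative of a real function $f$ that is absolutely continuous on every $[0,b]$, $b>0$. Solutions of the Cauchy problems below are understood to be absolutely continuous on every $[0,b]$. A solution satisfies its equation at every $t>0$; an a.e. solution satisfies it at almost every $t>0$.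 (i) For every real $v$ with $|v|\le 1$ the series $$G(v,t)=\sum_{k=0}^\infty(-\lambda t^\mu)^k(1-v)^kE^{\gamma k}_{\rho,\mu k+1}(-\phi t^\rho),\qquad t\ge 0,$$ converges absolutely, and $G(v,\cdot)$ is a solution of $${}^C\mathcal{D}^{\gamma,\mu}_{\rho,-\phi,0^+}G(v,t)=-\lambda(1-v)G(v,t),\qquad G(v,0)=1.$$ It is the only one: every a.e. solution of this problem coincides with it on $[0,\infty)$. (ii) Consider the system $${}^C\mathcal{D}^{\gamma,\mu}_{\rho,-\phi,0^+}p_k(t)=-\lambda p_k(t)+\lambda p_{k-1}(t),\quad k\ge 0,\qquad p_{-1}=0,\qquad p_0(0)=1,\quad p_k(0)=0\ (k\ge 1).$$ The series $$p_k(t)=\sum_{r=k}^\infty(-1)^{r-k}\binom{r}{k}(\lambda t^\mu)^rE^{\gamma r}_{\rho,\mu r+1}(-\phi t^\rho),\qquad k\ge 0,\ t\ge 0,$$ converge absolutely and solve the system, and every a.e. solution of the system coincides with them on $[0,\infty)$. For every a.e. solution $(p_k)$ and every real $|v|\le 1$, the generating function $\sum_{k}v^kp_k(t)$ converges for $t\ge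 0$, is a solution of the Cauchy problem in (i), and equals $G(v,t)$; moreover $\sum_k k\,p_k(t)=\lambda t^\mu E^\gamma_{\rho,1+\mu}(-\phi t^\rho)$ for $t\ge 0$. (iii) Let $N(t)$, $t\ge 0$, be random variables with values in $\{0,1,2,\dots\}$ on a probability space, whose state probabilities $p_k(t)=\Pr(N(t)=k)$ form an a.e. solution of the system in (ii). Then for every real $|v|\le 1$ the probability generating function $t\mapsto\mathbb{E}\,v^{N(t)}$ is a solution of the Cauchy problem in (i), and for all $t\ge 0$ we have $\mathbb{E}\,v^{N(t)}=G(v,t)$. Moreover, for all $t\ge 0$, $p_k(t)$ is given by the series in (ii), $N(t)$ is integrable, and $\mathbb{E}N(t)=\lambda t^\mu E^\gamma_{\rho,1+\mu}(-\phi t^\rho)$. -/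

import Mathlib

open MeasureTheory

noncomputable section

/-- The three-parameter (Prabhakar) Mittag-Leffler function
`E^γ_{ρ,μ}(x) = ∑ₖ Γ(γ+k) / (Γ(γ) Γ(ρk+μ)) · x^k / k!`. The ratio `Γ(γ+k)/Γ(γ)` is the rising
factorial `γ(γ+1)⋯(γ+k-1)`, which also gives its value when `γ` is a nonpositive integer.
For `ρ > 0` the series converges for every real `x`. -/
def prabhakarML (γ ρ μ x : ℝ) : ℝ :=
  ∑' k : ℕ, (ascPochhammer ℝ k).eval γ / Real.Gamma (ρ * k + μ) * (x ^ k / (k.factorial : ℝ))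

/-- The kernel `e^γ_{ρ,μ,ω}(t) = t^{μ-1} E^γ_{ρ,μ}(ω t^ρ)`, used for `t > 0`. -/
def prabhakarKernel (γ ρ μ ω t : ℝ) : ℝ :=
  t ^ (μ - 1) * prabhakarML γ ρ μ (ω * t ^ ρ)

open Classical in
/-- The Prabhakar integral `(𝐄^γ_{ρ,μ,ω,0+} f)(t) = ∫₀ᵗ e^γ_{ρ,μ,ω}(t-y) f(y) dy`,
with the convention `𝐄^0_{ρ,0,ω,0+} f = f`. -/
def prabhakarIntegral (γ ρ μ ω : ℝ) (f : ℝ → ℝ) (t : ℝ) : ℝ :=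
  if γ = 0 ∧ μ = 0 then f t
  else ∫ y in (0 : ℝ)..t, prabhakarKernel γ ρ μ ω (t - y) * f y

/-- The regularized Hilfer-Prabhakar derivative
`(ᶜ𝒟^{γ,μ}_{ρ,ω,0+} f)(t) = (𝐄^{-γ}_{ρ,1-μ,ω,0+} f')(t)`. -/
def regHilferPrabhakar (γ μ ρ ω : ℝ) (f : ℝ → ℝ) (t : ℝ) : ℝ :=
  prabhakarIntegral (-γ) ρ (1 - μ) ω (deriv f) t

/-- The regularized Hilfer-Prabhakar derivative of `f` at `t` is well defined (the convolution
integral converges, or, when the operator is the ordinary derivative, `f` is differentiable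
at `t`) and has the value `d`. -/
def HasRegHilferPrabhakarAt (γ μ ρ ω : ℝ) (f : ℝ → ℝ) (d t : ℝ) : Prop :=
  ((γ = 0 ∧ μ = 1) → DifferentiableAt ℝ f t) ∧
  (¬ (γ = 0 ∧ μ = 1) → IntervalIntegrable
    (fun y => prabhakarKernel (-γ) ρ (1 - μ) ω (t - y) * deriv f y) volume 0 t) ∧
  regHilferPrabhakar γ μ ρ ω f t = d

/-- `f` is a solution on `[0,∞)` of the Cauchy problem `ᶜ𝒟^{γ,μ}_{ρ,ω,0+} f = g`, `f(0) = c`: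
it is absolutely continuous on every `[0,b]`, and the equation holds at every `t > 0`. -/
structure IsCauchySolution (γ μ ρ ω : ℝ) (f : ℝ → ℝ) (c : ℝ) (g : ℝ → ℝ) : Prop where
  absCont : ∀ b > 0, AbsolutelyContinuousOnInterval f 0 b
  init : f 0 = c
  eqn : ∀ t > 0, HasRegHilferPrabhakarAt γ μ ρ ω f (g t) t

/-- As `IsCauchySolution`, but the equation is only required at almost every `t > 0`. -/
structure IsCauchySolutionAE (γ μ ρ ω : ℝ) (f : ℝ → ℝ) (c : ℝ) (g : ℝ → ℝ) : Prop where
  absCont : ∀ b > 0, AbsolutelyContinuousOnInterval f 0 b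
  init : f 0 = c
  eqn : ∀ᵐ t : ℝ, 0 < t → HasRegHilferPrabhakarAt γ μ ρ ω f (g t) t

/-- The right-hand side `-λ p_k(t) + λ p_{k-1}(t)` of the equations for the state probabilities,
with `p_{-1} = 0`. -/
def stateRHS (lam : ℝ) (p : ℕ → ℝ → ℝ) : ℕ → ℝ → ℝ
  | 0, t => -lam * p 0 t
  | k + 1, t => -lam * p (k + 1) t + lam * p k t

/-- The system `ᶜ𝒟^{γ,μ}_{ρ,-φ,0+} p_k = -λ p_k + λ p_{k-1}`, `p_k(0) = 1` if `k = 0` and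
`p_k(0) = 0` if `k ≥ 1`, with the equations holding at every `t > 0`. -/
def SolvesStateSystem (γ μ ρ φ lam : ℝ) (p : ℕ → ℝ → ℝ) : Prop :=
  ∀ k : ℕ, IsCauchySolution γ μ ρ (-φ) (p k) (if k = 0 then 1 else 0) (stateRHS lam p k)

/-- As `SolvesStateSystem`, with the equations holding at almost every `t > 0`. -/
def SolvesStateSystemAE (γ μ ρ φ lam : ℝ) (p : ℕ → ℝ → ℝ) : Prop :=
  ∀ k : ℕ, IsCauchySolutionAE γ μ ρ (-φ) (p k) (if k = 0 then 1 else 0) (stateRHS lam p k)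

/-- The `k`-th term `(-λ t^μ)^k (1-v)^k E^{γk}_{ρ,μk+1}(-φ t^ρ)` of the series for `G(v,t)`. -/
def pgfTerm (γ μ ρ φ lam v t : ℝ) (k : ℕ) : ℝ :=
  (-lam * t ^ μ) ^ k * (1 - v) ^ k * prabhakarML (γ * k) ρ (μ * k + 1) (-φ * t ^ ρ)

/-- `G(v,t) = ∑ₖ (-λ t^μ)^k (1-v)^k E^{γk}_{ρ,μk+1}(-φ t^ρ)`. -/
def pgfSeries (γ μ ρ φ lam v t : ℝ) : ℝ :=
  ∑' k : ℕ, pgfTerm γ μ ρ φ lam v t k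

/-- The term `(-1)^{r-k} (r choose k) (λ t^μ)^r E^{γr}_{ρ,μr+1}(-φ t^ρ)`, used for `r ≥ k`. -/
def stateTerm (γ μ ρ φ lam : ℝ) (k : ℕ) (t : ℝ) (r : ℕ) : ℝ :=
  (-1) ^ (r - k) * (r.choose k : ℝ) * (lam * t ^ μ) ^ r *
    prabhakarML (γ * r) ρ (μ * r + 1) (-φ * t ^ ρ)

/-- `p_k(t) = ∑_{r ≥ k} (-1)^{r-k} (r choose k) (λ t^μ)^r E^{γr}_{ρ,μr+1}(-φ t^ρ)`. -/
def stateSeries (γ μ ρ φ lam : ℝ) (k : ℕ) (t : ℝ) : ℝ :=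
  ∑' r : Set.Ici k, stateTerm γ μ ρ φ lam k t r

/-- `λ t^μ E^γ_{ρ,1+μ}(-φ t^ρ)`. -/
def meanFormula (γ μ ρ φ lam t : ℝ) : ℝ :=
  lam * t ^ μ * prabhakarML γ ρ (1 + μ) (-φ * t ^ ρ)

end

/-! Write `e^γ_μ` for the kernel `t^{μ-1} E^γ_{ρ,μ}(ω t^ρ)`, with `ρ`, `ω` fixed. It is a
superposition of Riemann-Liouville kernels of orders `ρk + μ` with coefficients `(γ)_k ω^k / k!`.
The beta integral and the Chu-Vandermonde identity therefore give the semigroup law `e^γ_μ ∗ e^σ_ν =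
e^{γ+σ}_{μ+ν}` (`integral_prabhakarKernel_mul`).

Since `e^0_1 = 1`, the kernels `e^{-γ}_{1-μ}` and `e^γ_μ` convolve to 1. Convolution with `e^γ_μ`
thus inverts the regularized derivative, and the Cauchy problem becomes the Volterra equation `f = c
+ e^γ_μ ∗ g` (`IsCauchySolutionAE.volterra`; conversely, for absolutely continuous `g`,
`IsCauchySolution.of_volterra`). The parameter condition enters through `μ < 1` for `γ ≠ 0`, which
makes both orders positive.

Iterating the convolution on the constant 1 produces the functions `t^{μr} E^{γr}_{ρ,μr+1}(ω t^ρ)`,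
so convolving a series in them shifts the index by one. Such a series solves the problem whose
right-hand side has the shifted coefficients (`isCauchySolution_tsum`), and the equations for `G`
and for `p_k` reduce to recurrences for coefficients, geometric in one case and Pascal's rule in the
other.

Under a weight `exp(s t)` with `s` large, convolution with the kernel has arbitrarily small norm on
`[0,b]`. This makes the iterates decay faster than any geometric sequence, which gives convergence,
and it makes the Volterra equation contractive, which gives uniqueness. The generating function and
the mean then follow by interchanging an absolutely convergent double sum and applying the binomial
theorem. -/

/-! ### Rising factorials and growth of the Gamma function -/

/-- `(γ)_k / k!`. -/
noncomputable def risingRatio (γ : ℝ) (k : ℕ) : ℝ :=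
  (ascPochhammer ℝ k).eval γ / (k.factorial : ℝ)

/-- The Riemann-Liouville kernel `t^{a-1} / Γ(a)`. -/
noncomputable def rlKernel (a t : ℝ) : ℝ := t ^ (a - 1) / Real.Gamma a

theorem risingRatio_zero_right (γ : ℝ) : risingRatio γ 0 = 1 := by simp [risingRatio]

theorem risingRatio_succ (γ : ℝ) (k : ℕ) :
    risingRatio γ (k + 1) = (γ + k) / (k + 1) * risingRatio γ k := by
  have : (k.factorial : ℝ) ≠ 0 := by positivity
  have h2 : (k + 1 : ℝ) ≠ 0 := by positivity
  simp only [risingRatio, ascPochhammer_succ_eval, Nat.factorial_succ]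
  push_cast
  field_simp

theorem risingRatio_nonneg {γ : ℝ} (hγ : 0 ≤ γ) (k : ℕ) : 0 ≤ risingRatio γ k := by
  induction k with
  | zero => simp [risingRatio_zero_right]
  | succ k ih => rw [risingRatio_succ]; positivity

theorem abs_risingRatio_le (γ : ℝ) (k : ℕ) : |risingRatio γ k| ≤ risingRatio |γ| k := by
  induction k with
  | zero => simp [risingRatio_zero_right]
  | succ k ih =>
    rw [risingRatio_succ, risingRatio_succ, abs_mul, abs_div, abs_of_pos (by positivity : (0:ℝ) < k + 1)]
    have : |γ + k| ≤ |γ| + k := (abs_add_le _ _).trans (by simp)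
    gcongr

/-- A crude geometric bound suffices, since the Gamma function in the denominators beats every
geometric rate. -/
theorem risingRatio_le_pow {γ : ℝ} (hγ : 0 ≤ γ) (k : ℕ) : risingRatio γ k ≤ (1 + γ) ^ k := by
  induction k with
  | zero => simp [risingRatio_zero_right]
  | succ k ih =>
    rw [risingRatio_succ, pow_succ']
    have h : (γ + k) / (k + 1) ≤ 1 + γ := by
      rw [div_le_iff₀ (by positivity)]
      have : 0 ≤ γ * k := by positivity
      nlinarith
    have := risingRatio_nonneg hγ k
    gcongr

theorem abs_risingRatio_le_pow (γ : ℝ) (k : ℕ) : |risingRatio γ k| ≤ (1 + |γ|) ^ k :=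
  (abs_risingRatio_le γ k).trans (risingRatio_le_pow (abs_nonneg γ) k)

/-- The Chu-Vandermonde identity for rising factorials. -/
theorem sum_antidiagonal_risingRatio (γ σ : ℝ) (n : ℕ) :
    ∑ ij ∈ Finset.HasAntidiagonal.antidiagonal n, risingRatio γ ij.1 * risingRatio σ ij.2 =
      risingRatio (γ + σ) n := by
  induction n with
  | zero => simp [risingRatio_zero_right]
  | succ n ih =>
    have hn : (n + 1 : ℝ) ≠ 0 := by positivity
    have hrec : ∀ (x : ℝ) (k : ℕ), ((k : ℝ) + 1) * risingRatio x (k + 1) = (x + k) * risingRatio x k := by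
      intro x k
      rw [risingRatio_succ]
      have : (k + 1 : ℝ) ≠ 0 := by positivity
      field_simp
    -- Multiply by `n + 1 = i + j` and split the weight. Index shifts turn the two halves into
    -- factors `γ + i` and `σ + j` over the antidiagonal of `n`, which add up to `γ + σ + n`.
    apply mul_left_cancel₀ hn
    rw [hrec, ← ih, Finset.mul_sum, Finset.mul_sum]
    have split : ∑ ij ∈ Finset.HasAntidiagonal.antidiagonal (n + 1), (n + 1 : ℝ) * (risingRatio γ ij.1 * risingRatio σ ij.2)
        = ∑ ij ∈ Finset.HasAntidiagonal.antidiagonal (n + 1), ((ij.1 : ℝ) * risingRatio γ ij.1) * risingRatio σ ij.2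
        + ∑ ij ∈ Finset.HasAntidiagonal.antidiagonal (n + 1), risingRatio γ ij.1 * ((ij.2 : ℝ) * risingRatio σ ij.2) := by
      rw [← Finset.sum_add_distrib]
      refine Finset.sum_congr rfl fun ij hij => ?_
      have : (ij.1 : ℝ) + ij.2 = n + 1 := by exact_mod_cast Finset.HasAntidiagonal.mem_antidiagonal.1 hij
      rw [← this]; ring
    rw [split, Finset.Nat.sum_antidiagonal_succ, Finset.Nat.sum_antidiagonal_succ']
    simp only [Nat.cast_zero, zero_mul, mul_zero, zero_add, Nat.cast_add, Nat.cast_one, hrec]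
    rw [← Finset.sum_add_distrib]
    refine Finset.sum_congr rfl fun ij hij => ?_
    have : (ij.1 : ℝ) + ij.2 = n := by exact_mod_cast Finset.HasAntidiagonal.mem_antidiagonal.1 hij
    rw [← this]; ring

/-- Restrict the Gamma integral to `u > x`, where `u^a ≥ x^a`. -/
theorem rpow_mul_exp_neg_le_Gamma {a x : ℝ} (ha : 0 ≤ a) (hx : 0 < x) :
    x ^ a * Real.exp (-x) ≤ Real.Gamma (a + 1) := by
  rw [Real.Gamma_eq_integral (by linarith)]
  have hint := Real.GammaIntegral_convergent (s := a + 1) (by linarith)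
  calc x ^ a * Real.exp (-x) = ∫ u in Set.Ioi x, Real.exp (-u) * x ^ a := by
        rw [integral_mul_const, integral_exp_neg_Ioi, mul_comm]
    _ ≤ ∫ u in Set.Ioi x, Real.exp (-u) * u ^ (a + 1 - 1) := by
        refine setIntegral_mono_on ((integrableOn_exp_neg_Ioi x).mul_const _)
          (hint.mono_set (Set.Ioi_subset_Ioi hx.le)) measurableSet_Ioi fun u hu => ?_
        rw [add_sub_cancel_right]
        have hu' : x ≤ u := (Set.mem_Ioi.1 hu).le
        gcongr
    _ ≤ ∫ u in Set.Ioi 0, Real.exp (-u) * u ^ (a + 1 - 1) := by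
        refine setIntegral_mono_set hint ?_ (Set.Ioi_subset_Ioi hx.le).eventuallyLE
        filter_upwards [ae_restrict_mem measurableSet_Ioi] with u hu
        have : 0 < u := hu
        positivity

theorem exists_inv_Gamma_le {ρ μ ε : ℝ} (hρ : 0 < ρ) (hμ : 0 < μ) (hε : 0 < ε) :
    ∃ C, 0 ≤ C ∧ ∀ n : ℕ, (Real.Gamma (ρ * n + μ))⁻¹ ≤ C * ε ^ n := by
  -- Chosen so that `x^{-ρn} = (ε/2)^n`; the spare `2^{-n}` absorbs the linear factor `ρn + μ`.
  set x : ℝ := (ε / 2) ^ (-ρ⁻¹) with hx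
  have hx0 : 0 < x := by positivity
  refine ⟨(ρ + μ) * Real.exp x * x ^ (-μ), by positivity, fun n => ?_⟩
  have ha : 0 < ρ * n + μ := by positivity
  have key := rpow_mul_exp_neg_le_Gamma ha.le hx0
  rw [Real.Gamma_add_one ha.ne'] at key
  have hG := Real.Gamma_pos_of_pos ha
  have hxn : x ^ (-(ρ * n)) = (ε / 2) ^ n := by
    rw [hx, ← Real.rpow_mul (by positivity), ← Real.rpow_natCast]
    congr 1
    field_simp
  have h1 : (Real.Gamma (ρ * n + μ))⁻¹ ≤ (ρ * n + μ) * (Real.exp x * x ^ (-(ρ * n + μ))) := by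
    rw [inv_le_iff_one_le_mul₀ hG]
    have e : Real.exp x * x ^ (-(ρ * n + μ)) * (x ^ (ρ * n + μ) * Real.exp (-x)) = 1 := by
      rw [Real.rpow_neg hx0.le, Real.exp_neg]
      have := (Real.rpow_pos_of_pos hx0 (ρ * n + μ)).ne'
      have := (Real.exp_pos x).ne'
      field_simp
    calc (1:ℝ) = Real.exp x * x ^ (-(ρ * n + μ)) * (x ^ (ρ * n + μ) * Real.exp (-x)) := e.symm
      _ ≤ Real.exp x * x ^ (-(ρ * n + μ)) * ((ρ * n + μ) * Real.Gamma (ρ * n + μ)) := by gcongr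
      _ = _ := by ring
  have h2 : ρ * n + μ ≤ (ρ + μ) * 2 ^ n := by
    have a1 : (n : ℝ) ≤ 2 ^ n := by exact_mod_cast Nat.lt_two_pow_self.le
    have a2 : (1 : ℝ) ≤ 2 ^ n := one_le_pow₀ (by norm_num)
    nlinarith
  calc _ ≤ (ρ * n + μ) * (Real.exp x * x ^ (-(ρ * n + μ))) := h1
    _ = (ρ * n + μ) * (Real.exp x * ((ε / 2) ^ n * x ^ (-μ))) := by
        rw [neg_add, Real.rpow_add hx0, hxn]
    _ ≤ ((ρ + μ) * 2 ^ n) * (Real.exp x * ((ε / 2) ^ n * x ^ (-μ))) := by gcongr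
    _ = _ := by rw [div_pow]; field_simp

/-! ### Riemann-Liouville kernels -/

theorem rlKernel_pos {a t : ℝ} (ha : 0 < a) (ht : 0 < t) : 0 < rlKernel a t :=
  div_pos (Real.rpow_pos_of_pos ht _) (Real.Gamma_pos_of_pos ha)

theorem rlKernel_nonneg {a t : ℝ} (ha : 0 < a) (ht : 0 ≤ t) : 0 ≤ rlKernel a t :=
  div_nonneg (Real.rpow_nonneg ht _) (Real.Gamma_pos_of_pos ha).le

/-- The semigroup property of the Riemann-Liouville kernels. -/
theorem integral_rlKernel_mul_rlKernel {a b t : ℝ} (ha : 0 < a) (hb : 0 < b) (ht : 0 < t) :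
    ∫ y in (0 : ℝ)..t, rlKernel a (t - y) * rlKernel b y = rlKernel (a + b) t := by
  have h1 : ∫ y in (0 : ℝ)..t, y ^ (b - 1) * (t - y) ^ (a - 1) =
      t ^ (a + b - 1) * (Real.Gamma a * Real.Gamma b / Real.Gamma (a + b)) := by
    have hc := Complex.betaIntegral_scaled b a ht
    rw [Complex.betaIntegral_eq_Gamma_mul_div _ _ (by simpa) (by simpa)] at hc
    apply Complex.ofReal_injective
    rw [← intervalIntegral.integral_ofReal]
    have : ∀ y ∈ Set.uIcc 0 t, ((y ^ (b - 1) * (t - y) ^ (a - 1) : ℝ) : ℂ) =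
        (y : ℂ) ^ ((b : ℂ) - 1) * ((t : ℂ) - y) ^ ((a : ℂ) - 1) := by
      intro y hy
      rw [Set.uIcc_of_le ht.le] at hy
      push_cast [Complex.ofReal_cpow hy.1, Complex.ofReal_cpow (sub_nonneg.2 hy.2)]
      rfl
    rw [intervalIntegral.integral_congr this, hc]
    push_cast [Complex.ofReal_cpow ht.le, ← Complex.Gamma_ofReal]
    rw [add_comm (b : ℂ) a, mul_comm (Complex.Gamma b)]
  have hGa := (Real.Gamma_pos_of_pos ha).ne'
  have hGb := (Real.Gamma_pos_of_pos hb).ne'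
  calc _ = ∫ y in (0 : ℝ)..t, (Real.Gamma a)⁻¹ * (Real.Gamma b)⁻¹ * (y ^ (b - 1) * (t - y) ^ (a - 1)) := by
        refine intervalIntegral.integral_congr fun y _ => ?_
        simp only [rlKernel]; field_simp
    _ = _ := by
        rw [intervalIntegral.integral_const_mul, h1, rlKernel]
        field_simp

/-- A non-integrable function has integral zero by convention, so the positive value just computed
already forces integrability. -/
theorem intervalIntegrable_rlKernel_mul_rlKernel {a b t : ℝ} (ha : 0 < a) (hb : 0 < b) (ht : 0 < t) :
    IntervalIntegrable (fun y => rlKernel a (t - y) * rlKernel b y) volume 0 t := by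
  apply intervalIntegral.intervalIntegrable_of_integral_ne_zero
  rw [integral_rlKernel_mul_rlKernel ha hb ht]
  exact (rlKernel_pos (add_pos ha hb) ht).ne'
theorem exists_rlKernel_le {ρ μ ε t : ℝ} (hρ : 0 < ρ) (hμ : 0 < μ) (hε : 0 < ε) (ht : 0 < t) :
    ∃ C, 0 ≤ C ∧ ∀ n : ℕ, rlKernel (ρ * n + μ) t ≤ C * ε ^ n := by
  have htρ : 0 < t ^ ρ := Real.rpow_pos_of_pos ht _
  obtain ⟨C, hC, h⟩ := exists_inv_Gamma_le (ε := ε / t ^ ρ) hρ hμ (by positivity)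
  refine ⟨C * t ^ (μ - 1), by positivity, fun n => ?_⟩
  have e : t ^ (ρ * n + μ - 1) = t ^ (μ - 1) * (t ^ ρ) ^ n := by
    rw [add_sub_assoc, Real.rpow_add ht, Real.rpow_mul_natCast ht.le, mul_comm]
  rw [rlKernel, e, div_eq_mul_inv]
  calc _ ≤ t ^ (μ - 1) * (t ^ ρ) ^ n * (C * (ε / t ^ ρ) ^ n) := by gcongr; exact h n
    _ = _ := by rw [div_pow]; field_simp

/-! ### The Prabhakar function and the semigroup law of its kernels -/

theorem prabhakarML_term_bound {ρ μ : ℝ} (hρ : 0 < ρ) (hμ : 0 < μ) (γ R : ℝ) :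
    ∃ u : ℕ → ℝ, Summable u ∧ ∀ (k : ℕ) (x : ℝ), |x| ≤ R →
      ‖(ascPochhammer ℝ k).eval γ / Real.Gamma (ρ * k + μ) * (x ^ k / (k.factorial : ℝ))‖ ≤ u k := by
  -- `1 + |R|` keeps `M` positive for every real `R`; the rate `(2M)⁻¹` leaves the majorant
  -- `2^{-k}`.
  set M : ℝ := (1 + |γ|) * (1 + |R|) with hM
  have hM0 : 0 < M := by positivity
  obtain ⟨C, hC, h⟩ := exists_inv_Gamma_le (ε := (2 * M)⁻¹) hρ hμ (by positivity)
  refine ⟨fun k => C * (1 / 2) ^ k, (summable_geometric_of_lt_one (by norm_num) (by norm_num)).mul_left _,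
    fun k x hx => ?_⟩
  have hG := Real.Gamma_pos_of_pos (by positivity : 0 < ρ * k + μ)
  have e : (ascPochhammer ℝ k).eval γ / Real.Gamma (ρ * k + μ) * (x ^ k / (k.factorial : ℝ)) =
      risingRatio γ k * x ^ k * (Real.Gamma (ρ * k + μ))⁻¹ := by
    rw [risingRatio]; field_simp
  have hx' : |x| ≤ 1 + |R| := hx.trans ((le_abs_self R).trans (by linarith))
  rw [e, Real.norm_eq_abs, abs_mul, abs_mul, abs_pow, abs_of_pos (inv_pos.2 hG)]
  calc _ ≤ (1 + |γ|) ^ k * (1 + |R|) ^ k * (C * (2 * M)⁻¹ ^ k) := by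
        gcongr
        · exact abs_risingRatio_le_pow γ k
        · exact h k
    _ = _ := by
        rw [← mul_pow, ← hM, mul_left_comm, ← mul_pow]
        congr 2
        field_simp

theorem continuous_prabhakarML {ρ μ : ℝ} (hρ : 0 < ρ) (hμ : 0 < μ) (γ : ℝ) :
    Continuous (prabhakarML γ ρ μ) := by
  rw [continuous_iff_continuousAt]
  intro x
  obtain ⟨u, hu, hb⟩ := prabhakarML_term_bound hρ hμ γ (|x| + 1)
  have h : ContinuousOn (prabhakarML γ ρ μ) (Metric.ball x 1) := by
    unfold prabhakarML
    refine continuousOn_tsum (fun k => by fun_prop) hu fun k y hy => hb k y ?_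
    have := abs_sub_abs_le_abs_sub y x
    rw [Metric.mem_ball, Real.dist_eq] at hy
    linarith
  exact h.continuousAt (Metric.ball_mem_nhds x one_pos)

theorem hasSum_prabhakarKernel {ρ μ t : ℝ} (hρ : 0 < ρ) (hμ : 0 < μ) (γ ω : ℝ) (ht : 0 < t) :
    HasSum (fun k : ℕ => risingRatio γ k * ω ^ k * rlKernel (ρ * k + μ) t)
      (prabhakarKernel γ ρ μ ω t) := by
  obtain ⟨u, hu, hb⟩ := prabhakarML_term_bound hρ hμ γ |ω * t ^ ρ|
  have hs := (Summable.of_norm_bounded hu fun k => hb k (ω * t ^ ρ) le_rfl).hasSum.mul_left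
    (t ^ (μ - 1))
  convert! hs using 1
  funext k
  have e : t ^ (ρ * k + μ - 1) = t ^ (μ - 1) * (t ^ ρ) ^ k := by
    rw [add_sub_assoc, Real.rpow_add ht, Real.rpow_mul_natCast ht.le, mul_comm]
  rw [rlKernel, risingRatio, e, mul_pow]
  field_simp

theorem measurable_prabhakarKernel {ρ μ : ℝ} (hρ : 0 < ρ) (hμ : 0 < μ) (γ ω : ℝ) :
    Measurable (prabhakarKernel γ ρ μ ω) := by
  have := (continuous_prabhakarML hρ hμ γ).measurable
  unfold prabhakarKernel
  fun_prop

/-- Termwise comparison of the expansions. The majorant has nonnegative terms, so its convolutions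
can be computed and bounded exactly. -/
theorem abs_prabhakarKernel_le {ρ μ t : ℝ} (hρ : 0 < ρ) (hμ : 0 < μ) (γ ω : ℝ) (ht : 0 < t) :
    |prabhakarKernel γ ρ μ ω t| ≤ prabhakarKernel |γ| ρ μ |ω| t := by
  refine (hasSum_prabhakarKernel hρ hμ γ ω ht).norm_le_of_bounded
    (hasSum_prabhakarKernel hρ hμ |γ| |ω| ht) fun k => ?_
  have := rlKernel_nonneg (by positivity : 0 < ρ * k + μ) ht.le
  rw [Real.norm_eq_abs, abs_mul, abs_mul, abs_pow, abs_of_nonneg this]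
  gcongr
  exact abs_risingRatio_le γ k

theorem prabhakarKernel_pos {γ ρ μ ω t : ℝ} (hρ : 0 < ρ) (hμ : 0 < μ) (hγ : 0 ≤ γ) (hω : 0 ≤ ω)
    (ht : 0 < t) : 0 < prabhakarKernel γ ρ μ ω t := by
  have h := hasSum_prabhakarKernel hρ hμ γ ω ht
  have hnn : ∀ k : ℕ, 0 ≤ risingRatio γ k * ω ^ k * rlKernel (ρ * k + μ) t := fun k => by
    have := rlKernel_nonneg (by positivity : 0 < ρ * k + μ) ht.le
    have := risingRatio_nonneg hγ k
    positivity
  refine lt_of_lt_of_le ?_ (le_hasSum h 0 fun k _ => hnn k)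
  simpa [risingRatio_zero_right] using rlKernel_pos hμ ht

/-- This is the kernel of ordinary integration, through which the semigroup law yields inverses and
antiderivatives. -/
theorem prabhakarKernel_zero_one {ρ ω t : ℝ} : prabhakarKernel 0 ρ 1 ω t = 1 := by
  have : prabhakarML 0 ρ 1 (ω * t ^ ρ) = 1 := by
    rw [prabhakarML, tsum_eq_single 0]
    · simp
    · intro k hk
      obtain ⟨n, rfl⟩ := Nat.exists_eq_succ_of_ne_zero hk
      simp
  simp [prabhakarKernel, this]

/-- The semigroup property of the Prabhakar kernels under convolution. -/
theorem integral_prabhakarKernel_mul {ρ μ ν t : ℝ} (hρ : 0 < ρ) (hμ : 0 < μ) (hν : 0 < ν)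
    (γ σ ω : ℝ) (ht : 0 < t) :
    ∫ y in (0 : ℝ)..t, prabhakarKernel γ ρ μ ω (t - y) * prabhakarKernel σ ρ ν ω y =
      prabhakarKernel (γ + σ) ρ (μ + ν) ω t := by
  set F : ℕ × ℕ → ℝ → ℝ := fun p y =>
    (risingRatio γ p.1 * ω ^ p.1 * rlKernel (ρ * p.1 + μ) (t - y)) *
      (risingRatio σ p.2 * ω ^ p.2 * rlKernel (ρ * p.2 + ν) y) with hF
  have hFe : ∀ p, F p = fun y => (risingRatio γ p.1 * ω ^ p.1 * (risingRatio σ p.2 * ω ^ p.2)) *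
      (rlKernel (ρ * p.1 + μ) (t - y) * rlKernel (ρ * p.2 + ν) y) := by
    intro p; funext y; simp only [hF]; ring
  have hp1 : ∀ p : ℕ × ℕ, 0 < ρ * p.1 + μ := fun p => by positivity
  have hp2 : ∀ p : ℕ × ℕ, 0 < ρ * p.2 + ν := fun p => by positivity
  have hint : ∀ p, Integrable (F p) (volume.restrict (Set.Ioo 0 t)) := fun p => by
    rw [hFe]
    refine Integrable.const_mul ?_ _
    exact ((intervalIntegrable_iff_integrableOn_Ioo_of_le ht.le).1
      (intervalIntegrable_rlKernel_mul_rlKernel (hp1 p) (hp2 p) ht))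
  have hval : ∀ (c : ℝ) (p : ℕ × ℕ), ∫ y in Set.Ioo 0 t,
      c * (rlKernel (ρ * p.1 + μ) (t - y) * rlKernel (ρ * p.2 + ν) y) =
      c * rlKernel (ρ * ((p.1 + p.2 : ℕ) : ℝ) + (μ + ν)) t := fun c p => by
    rw [← integral_Ioc_eq_integral_Ioo, ← intervalIntegral.integral_of_le ht.le,
      intervalIntegral.integral_const_mul, integral_rlKernel_mul_rlKernel (hp1 p) (hp2 p) ht]
    congr 2
    push_cast
    ring
  have hnorm : ∀ p, ∫ y in Set.Ioo 0 t, ‖F p y‖ =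
      |risingRatio γ p.1 * ω ^ p.1 * (risingRatio σ p.2 * ω ^ p.2)| *
        rlKernel (ρ * ((p.1 + p.2 : ℕ) : ℝ) + (μ + ν)) t := fun p => by
    rw [← hval]
    refine setIntegral_congr_fun measurableSet_Ioo fun y hy => ?_
    have h1 := rlKernel_nonneg (hp1 p) (sub_nonneg.2 hy.2.le)
    have h2 := rlKernel_nonneg (hp2 p) hy.1.le
    simp only [hFe, Real.norm_eq_abs]
    rw [abs_mul, abs_of_nonneg (mul_nonneg h1 h2)]
  -- The `L¹` norm of `F p` is its coefficient times a kernel depending only on `p.1 + p.2`. The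
  -- coefficient is at most `M^{p.1+p.2}`, so the rate `(2M)⁻¹` leaves a product of two geometric
  -- series.
  have hsum : Summable fun p => ∫ y in Set.Ioo 0 t, ‖F p y‖ := by
    set M : ℝ := (1 + |γ|) * (1 + |σ|) * (1 + |ω|) with hM
    have hM0 : 0 < M := by positivity
    obtain ⟨C, hC, h⟩ := exists_rlKernel_le (ε := (2 * M)⁻¹) hρ (add_pos hμ hν) (by positivity) ht
    have hgeo : Summable fun p : ℕ × ℕ => C * ((1 / 2 : ℝ) ^ p.1 * (1 / 2 : ℝ) ^ p.2) :=
      ((summable_geometric_of_lt_one (by norm_num) (by norm_num)).mul_of_nonneg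
        (summable_geometric_of_lt_one (by norm_num) (by norm_num))
        (fun _ => by positivity) fun _ => by positivity).mul_left C
    refine Summable.of_nonneg_of_le (fun p => integral_nonneg fun y => norm_nonneg _)
      (fun p => ?_) hgeo
    rw [hnorm, abs_mul, abs_mul, abs_mul, abs_pow, abs_pow]
    have b1 : |risingRatio γ p.1| * |ω| ^ p.1 ≤ M ^ p.1 :=
      calc _ ≤ (1 + |γ|) ^ p.1 * (1 + |ω|) ^ p.1 := by
            gcongr
            · exact abs_risingRatio_le_pow _ _
            · linarith
        _ = (((1 + |γ|) * 1) * (1 + |ω|)) ^ p.1 := by rw [mul_one, mul_pow]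
        _ ≤ M ^ p.1 := by rw [hM]; gcongr; linarith [abs_nonneg σ]
    have b2 : |risingRatio σ p.2| * |ω| ^ p.2 ≤ M ^ p.2 :=
      calc _ ≤ (1 + |σ|) ^ p.2 * (1 + |ω|) ^ p.2 := by
            gcongr
            · exact abs_risingRatio_le_pow _ _
            · linarith
        _ = ((1 * (1 + |σ|)) * (1 + |ω|)) ^ p.2 := by rw [one_mul, mul_pow]
        _ ≤ M ^ p.2 := by rw [hM]; gcongr; linarith [abs_nonneg γ]
    calc _ ≤ (M ^ p.1 * M ^ p.2) * (C * (2 * M)⁻¹ ^ (p.1 + p.2)) := by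
          have := h (p.1 + p.2)
          have := rlKernel_nonneg (by positivity : 0 < ρ * ((p.1 + p.2 : ℕ) : ℝ) + (μ + ν)) ht.le
          gcongr
      _ = C * ((M * (2 * M)⁻¹) ^ p.1 * (M * (2 * M)⁻¹) ^ p.2) := by
          rw [mul_pow M, mul_pow M, pow_add]; ring
      _ = _ := by
          have : M * (2 * M)⁻¹ = 1 / 2 := by field_simp
          rw [this]
  have key := hasSum_integral_of_summable_integral_norm hint hsum
  have hL : ∫ y in Set.Ioo 0 t, ∑' p, F p y =
      ∫ y in (0 : ℝ)..t, prabhakarKernel γ ρ μ ω (t - y) * prabhakarKernel σ ρ ν ω y := by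
    rw [intervalIntegral.integral_of_le ht.le, integral_Ioc_eq_integral_Ioo]
    refine setIntegral_congr_fun measurableSet_Ioo fun y hy => ?_
    have h1 := hasSum_prabhakarKernel hρ hμ γ ω (sub_pos.2 hy.2)
    have h2 := hasSum_prabhakarKernel hρ hν σ ω hy.1
    exact (h1.mul h2 (summable_mul_of_summable_norm h1.summable.norm h2.summable.norm)).tsum_eq
  rw [hL] at key
  -- Group the pairs by `p.1 + p.2 = n`; the kernel is constant on each group and Chu-Vandermonde
  -- sums the coefficients.
  have key2 := ((Finset.HasAntidiagonal.sigmaAntidiagonalEquivProd (A := ℕ)).hasSum_iff.2 key).sigma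
    fun n => hasSum_fintype _
  refine key2.unique ?_
  convert! hasSum_prabhakarKernel hρ (add_pos hμ hν) (γ + σ) ω ht using 1
  funext n
  rw [← sum_antidiagonal_risingRatio, Finset.sum_mul, Finset.sum_mul,
    Finset.sum_coe_sort_eq_attach]
  refine (Finset.sum_attach _ fun p => ∫ y in Set.Ioo 0 t, F p y).trans ?_
  refine Finset.sum_congr rfl fun p hp => ?_
  rw [Finset.HasAntidiagonal.mem_antidiagonal] at hp
  rw [hFe, hval, hp, ← hp, pow_add]
  ring
theorem intervalIntegrable_prabhakarKernel_mul {ρ μ ν t : ℝ} (hρ : 0 < ρ) (hμ : 0 < μ)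
    (hν : 0 < ν) (γ σ ω : ℝ) (ht : 0 < t) :
    IntervalIntegrable
      (fun y => prabhakarKernel γ ρ μ ω (t - y) * prabhakarKernel σ ρ ν ω y) volume 0 t := by
  have hmaj : IntervalIntegrable (fun y => prabhakarKernel |γ| ρ μ |ω| (t - y) *
      prabhakarKernel |σ| ρ ν |ω| y) volume 0 t := by
    apply intervalIntegral.intervalIntegrable_of_integral_ne_zero
    rw [integral_prabhakarKernel_mul hρ hμ hν _ _ _ ht]
    exact (prabhakarKernel_pos hρ (add_pos hμ hν) (by positivity) (by positivity) ht).ne'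
  rw [intervalIntegrable_iff_integrableOn_Ioo_of_le ht.le] at hmaj ⊢
  refine hmaj.mono' ?_ ?_
  · have h1 := measurable_prabhakarKernel hρ hμ γ ω
    have h2 := measurable_prabhakarKernel hρ hν σ ω
    exact Measurable.aestronglyMeasurable (by fun_prop)
  · filter_upwards [ae_restrict_mem measurableSet_Ioo] with y hy
    rw [norm_mul]
    exact mul_le_mul (abs_prabhakarKernel_le hρ hμ γ ω (sub_pos.2 hy.2))
      (abs_prabhakarKernel_le hρ hν σ ω hy.1) (norm_nonneg _)
      (prabhakarKernel_pos hρ hμ (abs_nonneg _) (abs_nonneg _) (sub_pos.2 hy.2)).le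

theorem integral_abs_prabhakarKernel_mul_le {ρ μ ν t : ℝ} (hρ : 0 < ρ) (hμ : 0 < μ)
    (hν : 0 < ν) (γ σ ω : ℝ) (ht : 0 < t) :
    ∫ y in (0 : ℝ)..t, |prabhakarKernel γ ρ μ ω (t - y) * prabhakarKernel σ ρ ν ω y| ≤
      prabhakarKernel (|γ| + |σ|) ρ (μ + ν) |ω| t := by
  rw [← integral_prabhakarKernel_mul hρ hμ hν _ _ _ ht]
  refine intervalIntegral.integral_mono_on_of_le_Ioo ht.le
    (intervalIntegrable_prabhakarKernel_mul hρ hμ hν γ σ ω ht).abs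
    (intervalIntegrable_prabhakarKernel_mul hρ hμ hν _ _ _ ht) fun y hy => ?_
  rw [abs_mul]
  exact mul_le_mul (abs_prabhakarKernel_le hρ hμ γ ω (sub_pos.2 hy.2))
      (abs_prabhakarKernel_le hρ hν σ ω hy.1) (abs_nonneg _)
      (prabhakarKernel_pos hρ hμ (abs_nonneg _) (abs_nonneg _) (sub_pos.2 hy.2)).le

theorem intervalIntegrable_prabhakarKernel {ρ μ t : ℝ} (hρ : 0 < ρ) (hμ : 0 < μ) (γ ω : ℝ)
    (ht : 0 ≤ t) : IntervalIntegrable (prabhakarKernel γ ρ μ ω) volume 0 t := by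
  rcases ht.eq_or_lt with rfl | ht
  · simp
  simpa [prabhakarKernel_zero_one] using
    intervalIntegrable_prabhakarKernel_mul hρ one_pos hμ 0 γ ω ht

theorem integral_prabhakarKernel {ρ μ t : ℝ} (hρ : 0 < ρ) (hμ : 0 < μ) (γ ω : ℝ) (ht : 0 < t) :
    ∫ y in (0 : ℝ)..t, prabhakarKernel γ ρ μ ω y = prabhakarKernel γ ρ (μ + 1) ω t := by
  simpa [prabhakarKernel_zero_one, add_comm] using
    integral_prabhakarKernel_mul hρ one_pos hμ 0 γ ω ht

theorem continuous_prabhakarKernel {ρ m : ℝ} (hρ : 0 < ρ) (hm : 1 ≤ m) (γ ω : ℝ) :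
    Continuous (prabhakarKernel γ ρ m ω) := by
  have h1 := continuous_prabhakarML hρ (by linarith : 0 < m) γ
  have h2 := Real.continuous_rpow_const hρ.le
  exact (Real.continuous_rpow_const (by linarith)).mul (h1.comp (continuous_const.mul h2))

theorem exists_prabhakarKernel_le {ρ m : ℝ} (hρ : 0 < ρ) (hm : 1 ≤ m) (γ ω b : ℝ) :
    ∃ M, ∀ x ∈ Set.Icc 0 b, prabhakarKernel γ ρ m ω x ≤ M := by
  obtain ⟨M, hM⟩ := isCompact_Icc.exists_bound_of_continuousOn (s := Set.Icc 0 b)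
    (continuous_prabhakarKernel hρ hm γ ω).continuousOn
  exact ⟨M, fun x hx => (le_abs_self _).trans (hM x hx)⟩

/-! ### Associativity of convolution -/

/-- Associativity of the convolution on `(0, t)` of two kernels whose absolute values have a
bounded convolution with an integrable function. -/
theorem convolution_assoc_of_bounded {A B f : ℝ → ℝ} {t M : ℝ} (ht : 0 ≤ t) (hA : Measurable A)
    (hB : Measurable B) (hf : IntervalIntegrable f volume 0 t)
    (hAB : ∀ x ∈ Set.Ioc 0 t, IntervalIntegrable (fun y => A (x - y) * B y) volume 0 x)
    (hM : ∀ x ∈ Set.Ioc 0 t, ∫ y in (0 : ℝ)..x, |A (x - y) * B y| ≤ M) :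
    IntervalIntegrable (fun y => A (t - y) * ∫ z in (0 : ℝ)..y, B (y - z) * f z) volume 0 t ∧
    ∫ y in (0 : ℝ)..t, A (t - y) * ∫ z in (0 : ℝ)..y, B (y - z) * f z =
      ∫ z in (0 : ℝ)..t, (∫ y in (0 : ℝ)..(t - z), A (t - z - y) * B y) * f z := by
  set m := (volume : Measure ℝ).restrict (Set.Ioo 0 t) with hm
  have hfi : Integrable f m := (intervalIntegrable_iff_integrableOn_Ioo_of_le ht).1 hf
  -- The indicator of `z < y` extends the integrand from the triangle to the square `(0,t)²`, where
  -- Fubini applies.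
  set K : ℝ × ℝ → ℝ := fun p => {p : ℝ × ℝ | p.2 < p.1}.indicator
    (fun p => A (t - p.1) * B (p.1 - p.2)) p with hK
  have hKm : Measurable K := Measurable.indicator (by fun_prop)
    (measurableSet_lt measurable_snd measurable_fst)
  have hKz : ∀ z, (fun y => K (y, z)) =
      (Set.Ioi z).indicator (fun y => A (t - z - (y - z)) * B (y - z)) := by
    intro z; funext y
    by_cases h : z < y
    · simp [hK, h]
    · simp [hK, h]
  have hset : ∀ z ∈ Set.Ioo 0 t, Set.Ioo 0 t ∩ Set.Ioi z = Set.Ioo z t := by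
    intro z hz; ext y; simp only [Set.mem_inter_iff, Set.mem_Ioo, Set.mem_Ioi]
    constructor
    · rintro ⟨⟨_, h2⟩, h3⟩; exact ⟨h3, h2⟩
    · rintro ⟨h1, h2⟩; exact ⟨⟨hz.1.trans h1, h2⟩, h1⟩
  have hmem : ∀ z ∈ Set.Ioo 0 t, t - z ∈ Set.Ioc 0 t := fun z hz =>
    ⟨sub_pos.2 hz.2, by linarith [hz.1]⟩
  have hslice : ∀ z ∈ Set.Ioo 0 t, Integrable (fun y => K (y, z)) m := by
    intro z hz
    rw [hKz, hm, integrable_indicator_iff measurableSet_Ioi, IntegrableOn,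
      Measure.restrict_restrict measurableSet_Ioi, Set.inter_comm, hset z hz]
    have := (hAB _ (hmem z hz)).comp_sub_right z
    rw [zero_add, sub_add_cancel, intervalIntegrable_iff_integrableOn_Ioo_of_le hz.2.le] at this
    exact this
  -- The norm, taken as `g`, gives the bound for Fubini, and the identity gives the value. The
  -- condition `g 0 = 0` lets `g` pass through the indicator.
  have hslice_int : ∀ (g : ℝ → ℝ), g 0 = 0 → ∀ z ∈ Set.Ioo 0 t, ∫ y, g (K (y, z)) ∂m =
      ∫ y in (0 : ℝ)..(t - z), g (A (t - z - y) * B y) := by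
    intro g hg z hz
    have e : (fun y => g (K (y, z))) =
        (Set.Ioi z).indicator (fun y => g (A (t - z - (y - z)) * B (y - z))) := by
      funext y
      rw [show K (y, z) = _ from congrFun (hKz z) y]
      by_cases h : y ∈ Set.Ioi z
      · rw [Set.indicator_of_mem h, Set.indicator_of_mem h]
      · rw [Set.indicator_of_notMem h, Set.indicator_of_notMem h, hg]
    rw [e, hm, integral_indicator measurableSet_Ioi, Measure.restrict_restrict measurableSet_Ioi,
      Set.inter_comm, hset z hz, ← integral_Ioc_eq_integral_Ioo,
      ← intervalIntegral.integral_of_le hz.2.le,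
      intervalIntegral.integral_comp_sub_right (fun y => g (A (t - z - y) * B y)) z, sub_self]
  have hFm : AEStronglyMeasurable (fun p : ℝ × ℝ => K p * f p.2) (m.prod m) :=
    hKm.aestronglyMeasurable.mul (hfi.aestronglyMeasurable.comp_snd)
  have hF : Integrable (fun p : ℝ × ℝ => K p * f p.2) (m.prod m) := by
    rw [integrable_prod_iff' hFm]
    constructor
    · filter_upwards [ae_restrict_mem measurableSet_Ioo] with z hz
      exact (hslice z hz).mul_const _
    · refine (hfi.norm.const_mul M).mono' hFm.norm.prod_swap.integral_prod_right' ?_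
      filter_upwards [ae_restrict_mem measurableSet_Ioo] with z hz
      simp only [norm_mul]
      rw [integral_mul_const, norm_mul, norm_norm,
        Real.norm_of_nonneg (integral_nonneg fun _ => norm_nonneg _)]
      gcongr
      exact (hslice_int (fun x => ‖x‖) norm_zero z hz).trans_le (hM _ (hmem z hz))
  have hinner : ∀ y ∈ Set.Ioo 0 t, ∫ z, K (y, z) * f z ∂m =
      A (t - y) * ∫ z in (0 : ℝ)..y, B (y - z) * f z := by
    intro y hy
    have e : (fun z => K (y, z) * f z) =
        (Set.Iio y).indicator (fun z => A (t - y) * (B (y - z) * f z)) := by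
      funext z
      by_cases h : z < y
      · simp [hK, h, mul_assoc]
      · simp [hK, h]
    have hs : Set.Ioo 0 t ∩ Set.Iio y = Set.Ioo 0 y := by
      ext z; simp only [Set.mem_inter_iff, Set.mem_Ioo, Set.mem_Iio]
      constructor
      · rintro ⟨⟨h1, _⟩, h3⟩; exact ⟨h1, h3⟩
      · rintro ⟨h1, h2⟩; exact ⟨⟨h1, h2.trans hy.2⟩, h2⟩
    rw [e, hm, integral_indicator measurableSet_Iio, Measure.restrict_restrict measurableSet_Iio,
      Set.inter_comm, hs, ← integral_Ioc_eq_integral_Ioo,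
      ← intervalIntegral.integral_of_le hy.1.le, intervalIntegral.integral_const_mul]
  constructor
  · rw [intervalIntegrable_iff_integrableOn_Ioo_of_le ht]
    exact hF.integral_prod_left.congr
      ((ae_restrict_mem measurableSet_Ioo).mono fun y hy => hinner y hy)
  · rw [intervalIntegral.integral_of_le ht, intervalIntegral.integral_of_le ht,
      integral_Ioc_eq_integral_Ioo, integral_Ioc_eq_integral_Ioo]
    rw [← setIntegral_congr_fun measurableSet_Ioo hinner]
    rw [integral_integral_swap hF]
    refine setIntegral_congr_fun measurableSet_Ioo fun z hz => ?_
    rw [integral_mul_const, hslice_int (fun x => x) rfl z hz]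

/-- The condition `μ + ν ≥ 1` makes the composed majorant kernel continuous up to 0, hence bounded
on `[0,t]`, so `f` need only be integrable. -/
theorem prabhakarKernel_convolution_assoc {ρ μ ν t : ℝ} (hρ : 0 < ρ) (hμ : 0 < μ) (hν : 0 < ν)
    (hμν : 1 ≤ μ + ν) (γ σ ω : ℝ) {f : ℝ → ℝ} (ht : 0 ≤ t)
    (hf : IntervalIntegrable f volume 0 t) :
    IntervalIntegrable (fun y => prabhakarKernel γ ρ μ ω (t - y) *
      ∫ z in (0 : ℝ)..y, prabhakarKernel σ ρ ν ω (y - z) * f z) volume 0 t ∧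
    ∫ y in (0 : ℝ)..t, prabhakarKernel γ ρ μ ω (t - y) *
        ∫ z in (0 : ℝ)..y, prabhakarKernel σ ρ ν ω (y - z) * f z =
      ∫ z in (0 : ℝ)..t, prabhakarKernel (γ + σ) ρ (μ + ν) ω (t - z) * f z := by
  obtain ⟨M, hM⟩ := exists_prabhakarKernel_le hρ hμν (|γ| + |σ|) |ω| t
  have h := convolution_assoc_of_bounded ht (measurable_prabhakarKernel hρ hμ γ ω)
    (measurable_prabhakarKernel hρ hν σ ω) hf
    (fun x hx => intervalIntegrable_prabhakarKernel_mul hρ hμ hν γ σ ω hx.1)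
    (fun x hx => (integral_abs_prabhakarKernel_mul_le hρ hμ hν γ σ ω hx.1).trans
      (hM x ⟨hx.1.le, hx.2⟩))
  refine ⟨h.1, h.2.trans ?_⟩
  rw [intervalIntegral.integral_of_le ht, intervalIntegral.integral_of_le ht,
    integral_Ioc_eq_integral_Ioo, integral_Ioc_eq_integral_Ioo]
  refine setIntegral_congr_fun measurableSet_Ioo fun z hz => ?_
  rw [integral_prabhakarKernel_mul hρ hμ hν γ σ ω (sub_pos.2 hz.2)]
-- Equivalence of the Cauchy problem and a Volterra equation
theorem AbsolutelyContinuousOnInterval.congr_uIcc {f g : ℝ → ℝ} {a b : ℝ}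
    (hf : AbsolutelyContinuousOnInterval f a b) (h : ∀ x ∈ Set.uIcc a b, f x = g x) :
    AbsolutelyContinuousOnInterval g a b := by
  refine Filter.Tendsto.congr' ?_ hf
  refine Filter.mem_inf_of_right (Filter.mem_principal.2 fun E hE => ?_)
  refine Finset.sum_congr rfl fun i hi => ?_
  obtain ⟨h1, h2⟩ := hE.1 i hi
  rw [h _ h1, h _ h2]

theorem absolutelyContinuousOnInterval_const (c a b : ℝ) :
    AbsolutelyContinuousOnInterval (fun _ : ℝ => c) a b :=
  (LipschitzWith.const c).lipschitzOnWith.absolutelyContinuousOnInterval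

theorem intervalIntegrable_prabhakarKernel_sub {ρ μ t : ℝ} (hρ : 0 < ρ) (hμ : 0 < μ) (γ ω : ℝ)
    (ht : 0 ≤ t) : IntervalIntegrable (fun y => prabhakarKernel γ ρ μ ω (t - y)) volume 0 t := by
  have := (intervalIntegrable_prabhakarKernel hρ hμ γ ω ht).comp_sub_left t
  simpa using this.symm

theorem intervalIntegrable_prabhakarKernel_sub_mul {ρ μ t : ℝ} (hρ : 0 < ρ) (hμ : 0 < μ) (γ ω : ℝ)
    (ht : 0 ≤ t) {f : ℝ → ℝ} (hf : ContinuousOn f (Set.Icc 0 t)) :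
    IntervalIntegrable (fun y => prabhakarKernel γ ρ μ ω (t - y) * f y) volume 0 t :=
  (intervalIntegrable_prabhakarKernel_sub hρ hμ γ ω ht).mul_continuousOn
    (by rwa [Set.uIcc_of_le ht])

theorem regHilferPrabhakar_eq_integral {γ μ : ℝ} (h : ¬ (γ = 0 ∧ μ = 1)) (ρ ω : ℝ) (f : ℝ → ℝ)
    (t : ℝ) : regHilferPrabhakar γ μ ρ ω f t =
      ∫ y in (0 : ℝ)..t, prabhakarKernel (-γ) ρ (1 - μ) ω (t - y) * deriv f y := by
  have h' : ¬ (-γ = 0 ∧ 1 - μ = 0) := fun h2 => h ⟨by linarith [h2.1], by linarith [h2.2]⟩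
  rw [regHilferPrabhakar, prabhakarIntegral, if_neg h']

theorem regHilferPrabhakar_zero_one (ρ ω : ℝ) (f : ℝ → ℝ) (t : ℝ) :
    regHilferPrabhakar 0 1 ρ ω f t = deriv f t := by
  simp [regHilferPrabhakar, prabhakarIntegral]

/-- An a.e. solution of a Cauchy problem solves the equivalent Volterra equation. -/
theorem IsCauchySolutionAE.volterra {γ μ ρ ω c : ℝ} {f g : ℝ → ℝ} (hρ : 0 < ρ) (hμ : 0 < μ)
    (hμ1 : μ ≤ 1) (hγμ : γ ≠ 0 → μ < 1) (hf : IsCauchySolutionAE γ μ ρ ω f c g) {t : ℝ}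
    (ht : 0 ≤ t) :
    f t = c + ∫ y in (0 : ℝ)..t, prabhakarKernel γ ρ μ ω (t - y) * g y := by
  rcases ht.eq_or_lt with rfl | ht0
  · simp [hf.init]
  have hac := hf.absCont t ht0
  have hftc := hac.integral_deriv_eq_sub
  rw [hf.init] at hftc
  have hd := hac.boundedVariationOn.intervalIntegrable_deriv
  suffices ∫ y in (0 : ℝ)..t, prabhakarKernel γ ρ μ ω (t - y) * g y =
      ∫ y in (0 : ℝ)..t, deriv f y by rw [this, hftc]; ring
  have hg : ∀ᵐ y : ℝ, y ∈ Set.uIoc 0 t → g y = regHilferPrabhakar γ μ ρ ω f y := by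
    filter_upwards [hf.eqn] with y hy hmem
    rw [Set.uIoc_of_le ht] at hmem
    exact (hy hmem.1).2.2.symm
  by_cases h : γ = 0 ∧ μ = 1
  · obtain ⟨rfl, rfl⟩ := h
    refine intervalIntegral.integral_congr_ae ?_
    filter_upwards [hg] with y hy hmem
    rw [hy hmem, regHilferPrabhakar_zero_one, prabhakarKernel_zero_one, one_mul]
  · have hμlt : μ < 1 := by
      by_cases h0 : γ = 0
      · exact lt_of_le_of_ne hμ1 fun h1 => h ⟨h0, h1⟩
      · exact hγμ h0
    -- The composed kernel has parameters `γ - γ = 0` and `μ + (1 - μ) = 1`, hence is 1: only `∫ f'`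
    -- remains.
    have hassoc := (prabhakarKernel_convolution_assoc hρ hμ (sub_pos.2 hμlt) (by linarith)
      γ (-γ) ω ht hd).2
    simp only [add_neg_cancel, add_sub_cancel, prabhakarKernel_zero_one, one_mul] at hassoc
    rw [← hassoc]
    refine intervalIntegral.integral_congr_ae ?_
    filter_upwards [hg] with y hy hmem
    rw [hy hmem, regHilferPrabhakar_eq_integral h]

/-- A solution of the Volterra equation with an absolutely continuous right-hand side solves the
Cauchy problem. -/
theorem IsCauchySolution.of_volterra {γ μ ρ ω c : ℝ} {f g : ℝ → ℝ} (hρ : 0 < ρ) (hμ : 0 < μ)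
    (hμ1 : μ ≤ 1) (hγμ : γ ≠ 0 → μ < 1) (hg : ∀ b > 0, AbsolutelyContinuousOnInterval g 0 b)
    (hf : ∀ t, 0 ≤ t →
      f t = c + ∫ y in (0 : ℝ)..t, prabhakarKernel γ ρ μ ω (t - y) * g y) :
    IsCauchySolution γ μ ρ ω f c g := by
  have hd : ∀ t, 0 < t → IntervalIntegrable (deriv g) volume 0 t := fun t ht =>
    (hg t ht).boundedVariationOn.intervalIntegrable_deriv
  have hgi : ∀ t, 0 < t → ∀ y ∈ Set.Icc 0 t, g y = g 0 + ∫ z in (0 : ℝ)..y, deriv g z := by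
    intro t ht y hy
    have := ((hg t ht).mono (c := 0) (d := y)
      (by rw [Set.uIcc_of_le hy.1, Set.uIcc_of_le ht.le]; exact Set.Icc_subset_Icc_right hy.2)
      ).integral_deriv_eq_sub
    rw [this]; ring
  -- The almost-everywhere derivative of `e ∗ g`, obtained from `g = g(0) + 1 ∗ g'` as `g(0) e + e ∗
  -- g'`.
  set ψ : ℝ → ℝ := fun y => g 0 * prabhakarKernel γ ρ μ ω y +
    ∫ z in (0 : ℝ)..y, prabhakarKernel γ ρ μ ω (y - z) * deriv g z with hψ
  have h1ψ : ∀ t, 0 < t →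
      IntervalIntegrable (fun y => ∫ z in (0 : ℝ)..y, prabhakarKernel γ ρ μ ω (y - z) * deriv g z)
        volume 0 t ∧
      ∫ y in (0 : ℝ)..t, ∫ z in (0 : ℝ)..y, prabhakarKernel γ ρ μ ω (y - z) * deriv g z =
        ∫ z in (0 : ℝ)..t, prabhakarKernel γ ρ (μ + 1) ω (t - z) * deriv g z := by
    intro t ht
    simpa [prabhakarKernel_zero_one, add_comm] using
      prabhakarKernel_convolution_assoc hρ one_pos hμ (by linarith) 0 γ ω ht.le (hd t ht)
  have hψi : ∀ t, 0 < t → IntervalIntegrable ψ volume 0 t := fun t ht =>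
    ((intervalIntegrable_prabhakarKernel hρ hμ γ ω ht.le).const_mul _).add (h1ψ t ht).1
  have hfψ : ∀ t, 0 ≤ t → f t = c + ∫ y in (0 : ℝ)..t, ψ y := by
    intro t ht
    rw [hf t ht]
    rcases ht.eq_or_lt with rfl | ht0
    · simp
    congr 1
    -- Both `e ∗ (1 ∗ g')` and `1 ∗ (e ∗ g')` equal the kernel of order `μ + 1` convolved with `g'`.
    have hA := prabhakarKernel_convolution_assoc hρ hμ one_pos (by linarith) γ 0 ω ht (hd t ht0)
    simp only [prabhakarKernel_zero_one, one_mul, add_zero] at hA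
    calc _ = ∫ y in (0 : ℝ)..t, (g 0 * prabhakarKernel γ ρ μ ω (t - y) +
          prabhakarKernel γ ρ μ ω (t - y) * ∫ z in (0 : ℝ)..y, deriv g z) := by
          refine intervalIntegral.integral_congr fun y hy => ?_
          rw [Set.uIcc_of_le ht] at hy
          simp only [hgi t ht0 y hy]
          ring
      _ = _ := by
          rw [intervalIntegral.integral_add
            ((intervalIntegrable_prabhakarKernel_sub hρ hμ γ ω ht).const_mul _) hA.1, hA.2,
            intervalIntegral.integral_add
            ((intervalIntegrable_prabhakarKernel hρ hμ γ ω ht).const_mul _) (h1ψ t ht0).1,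
            (h1ψ t ht0).2, intervalIntegral.integral_const_mul,
            intervalIntegral.integral_const_mul,
            intervalIntegral.integral_comp_sub_left (fun y => prabhakarKernel γ ρ μ ω y)]
          simp
  have hfd : ∀ t, 0 < t → ∀ᵐ y : ℝ, y ∈ Set.uIoc 0 t → deriv f y = ψ y := by
    intro t ht
    filter_upwards [(hψi t ht).ae_hasDerivAt_integral] with y hy hmem
    have h2 := hy (Set.uIoc_subset_uIcc hmem) 0 (by simp)
    rw [Set.uIoc_of_le ht.le] at hmem
    refine ((h2.const_add c).congr_of_eventuallyEq ?_).deriv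
    filter_upwards [lt_mem_nhds hmem.1] with x hx using hfψ x hx.le
  -- In the ordinary-derivative case the equation is needed at every `t`, so the continuity of `g`
  -- is used in place of the almost-everywhere formula.
  have hordinary : γ = 0 ∧ μ = 1 → ∀ t, 0 < t → HasDerivAt f (g t) t := by
    rintro ⟨rfl, rfl⟩ t ht
    have hc : ContinuousOn g (Set.Icc 0 (t + 1)) := by
      have := (hg (t + 1) (by linarith)).continuousOn
      rwa [Set.uIcc_of_le (by linarith)] at this
    have hc' : ContinuousOn g (Set.Ioo 0 (t + 1)) := hc.mono Set.Ioo_subset_Icc_self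
    have hmem : t ∈ Set.Ioo 0 (t + 1) := ⟨ht, by linarith⟩
    have h1 := intervalIntegral.integral_hasDerivAt_right (f := g) (a := 0) (b := t)
      (ContinuousOn.intervalIntegrable (by
        rw [Set.uIcc_of_le ht.le]; exact hc.mono (Set.Icc_subset_Icc_right (by linarith))))
      (hc'.stronglyMeasurableAtFilter isOpen_Ioo t hmem)
      (hc'.continuousAt (Ioo_mem_nhds hmem.1 hmem.2))
    refine (h1.const_add c).congr_of_eventuallyEq ?_
    filter_upwards [lt_mem_nhds ht] with x hx
    simpa [prabhakarKernel_zero_one] using hf x hx.le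
  have hconv : ¬ (γ = 0 ∧ μ = 1) → ∀ t, 0 < t →
      IntervalIntegrable (fun y => prabhakarKernel (-γ) ρ (1 - μ) ω (t - y) * deriv f y)
        volume 0 t ∧
      ∫ y in (0 : ℝ)..t, prabhakarKernel (-γ) ρ (1 - μ) ω (t - y) * deriv f y = g t := by
    intro h t ht
    have hμlt : μ < 1 := by
      by_cases h0 : γ = 0
      · exact lt_of_le_of_ne hμ1 fun h1 => h ⟨h0, h1⟩
      · exact hγμ h0
    have hμ' : 0 < 1 - μ := sub_pos.2 hμlt
    have hA := prabhakarKernel_convolution_assoc hρ hμ' hμ (by linarith) (-γ) γ ω ht.le (hd t ht)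
    have hB := intervalIntegrable_prabhakarKernel_mul hρ hμ' hμ (-γ) γ ω ht
    have hC := integral_prabhakarKernel_mul hρ hμ' hμ (-γ) γ ω ht
    simp only [neg_add_cancel, sub_add_cancel, prabhakarKernel_zero_one, one_mul] at hA hC
    have hae : ∀ᵐ y : ℝ, y ∈ Set.uIoc 0 t →
        prabhakarKernel (-γ) ρ (1 - μ) ω (t - y) * deriv f y =
        g 0 * (prabhakarKernel (-γ) ρ (1 - μ) ω (t - y) * prabhakarKernel γ ρ μ ω y) +
        prabhakarKernel (-γ) ρ (1 - μ) ω (t - y) *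
          ∫ z in (0 : ℝ)..y, prabhakarKernel γ ρ μ ω (y - z) * deriv g z := by
      filter_upwards [hfd t ht] with y hy hmem
      rw [hy hmem, hψ]
      ring
    constructor
    · exact ((hB.const_mul (g 0)).add hA.1).congr_ae
        ((ae_restrict_iff' measurableSet_uIoc).2 (hae.mono fun y hy hmem => (hy hmem).symm))
    · rw [intervalIntegral.integral_congr_ae hae,
        intervalIntegral.integral_add (hB.const_mul (g 0)) hA.1, hA.2,
        intervalIntegral.integral_const_mul, hC, mul_one, hgi t ht t ⟨ht.le, le_rfl⟩]
  refine ⟨fun b hb => ?_, by simp [hf 0 le_rfl], fun t ht =>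
    ⟨fun h => (hordinary h t ht).differentiableAt, fun h => (hconv h t ht).1, ?_⟩⟩
  · refine ((absolutelyContinuousOnInterval_const c 0 b).add
      ((hψi b hb).absolutelyContinuousOnInterval_intervalIntegral (c := 0) (by simp))).congr_uIcc
      fun x hx => ?_
    rw [Set.uIcc_of_le hb.le] at hx
    rw [hfψ x hx.1, Pi.add_apply]
  · by_cases h : γ = 0 ∧ μ = 1
    · have := (hordinary h t ht).deriv
      obtain ⟨rfl, rfl⟩ := h
      rw [regHilferPrabhakar_zero_one, this]
    · rw [regHilferPrabhakar_eq_integral h, (hconv h t ht).2]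

/-- The Volterra form sees only values on `[0,∞)`, so a solution may be altered at negative times.
This matters because the series formulas hold only for `t ≥ 0`. -/
theorem IsCauchySolution.congr {γ μ ρ ω c : ℝ} {f g f' g' : ℝ → ℝ} (hρ : 0 < ρ) (hμ : 0 < μ)
    (hμ1 : μ ≤ 1) (hγμ : γ ≠ 0 → μ < 1) (hf : IsCauchySolution γ μ ρ ω f c g)
    (hg : ∀ b > 0, AbsolutelyContinuousOnInterval g 0 b)
    (hff' : ∀ t, 0 ≤ t → f t = f' t) (hgg' : ∀ t, 0 ≤ t → g t = g' t) :
    IsCauchySolution γ μ ρ ω f' c g' := by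
  refine .of_volterra hρ hμ hμ1 hγμ (fun b hb => (hg b hb).congr_uIcc fun x hx => ?_)
    fun t ht => ?_
  · rw [Set.uIcc_of_le hb.le] at hx
    exact hgg' x hx.1
  · have hae : IsCauchySolutionAE γ μ ρ ω f c g :=
      ⟨hf.absCont, hf.init, .of_forall hf.eqn⟩
    rw [← hff' t ht, hae.volterra hρ hμ hμ1 hγμ ht]
    congr 1
    refine intervalIntegral.integral_congr fun y hy => ?_
    rw [Set.uIcc_of_le ht] at hy
    simp only [hgg' y hy.1]

/-! ### Exponential weights and uniqueness for the Volterra equation -/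

/-- Exponential weights make the kernel small. -/
theorem exists_integral_abs_prabhakarKernel_exp_le {ρ μ b ε : ℝ} (hρ : 0 < ρ) (hμ : 0 < μ)
    (γ ω : ℝ) (hb : 0 ≤ b) (hε : 0 < ε) :
    ∃ s : ℝ, 0 ≤ s ∧ ∀ t ∈ Set.Icc 0 b,
      ∫ y in (0 : ℝ)..t, |prabhakarKernel γ ρ μ ω (t - y)| * Real.exp (s * y) ≤
        ε * Real.exp (s * t) := by
  have hi := (intervalIntegrable_prabhakarKernel hρ hμ γ ω hb).abs
  have hexp : ∀ s : ℝ, ContinuousOn (fun y => Real.exp (-(s * y))) (Set.uIcc 0 b) := fun s => by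
    fun_prop
  -- Dominated convergence: the weight tends to 0 for each `y > 0` and the kernel is integrable.
  have hlim : Filter.Tendsto (fun n : ℕ => ∫ y in (0 : ℝ)..b,
      |prabhakarKernel γ ρ μ ω y| * Real.exp (-((n : ℝ) * y))) Filter.atTop (nhds 0) := by
    have h0 : (0 : ℝ) = ∫ _ in (0 : ℝ)..b, (0 : ℝ) := by simp
    conv => arg 3; rw [h0]
    refine intervalIntegral.tendsto_integral_filter_of_dominated_convergence
      (l := Filter.atTop) (F := fun n y => |prabhakarKernel γ ρ μ ω y| * Real.exp (-((n : ℕ) * y)))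
      (fun y => |prabhakarKernel γ ρ μ ω y|) (.of_forall fun n => ?_) (.of_forall fun n => ?_) hi ?_
    · exact (hi.mul_continuousOn (hexp n)).def'.aestronglyMeasurable
    · refine .of_forall fun y hy => ?_
      rw [Set.uIoc_of_le hb] at hy
      rw [norm_mul, Real.norm_eq_abs, abs_abs, Real.norm_eq_abs, Real.abs_exp]
      have h1 : 0 ≤ (n : ℝ) * y := mul_nonneg (Nat.cast_nonneg n) hy.1.le
      exact mul_le_of_le_one_right (abs_nonneg _) (Real.exp_le_one_iff.2 (by linarith))
    · refine .of_forall fun y hy => ?_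
      rw [Set.uIoc_of_le hb] at hy
      rw [← mul_zero |prabhakarKernel γ ρ μ ω y|]
      refine Filter.Tendsto.const_mul _ (Real.tendsto_exp_neg_atTop_nhds_zero.comp ?_)
      exact tendsto_natCast_atTop_atTop.atTop_mul_const hy.1
  obtain ⟨n, hn⟩ := (hlim.eventually (gt_mem_nhds hε)).exists
  refine ⟨n, Nat.cast_nonneg n, fun t ht => ?_⟩
  have hsubst := intervalIntegral.integral_comp_sub_left (a := 0) (b := t)
    (fun y => |prabhakarKernel γ ρ μ ω y| * Real.exp ((n : ℝ) * (t - y))) t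
  simp only [sub_sub_cancel, sub_self, sub_zero] at hsubst
  rw [hsubst]
  have hfac : ∀ y, |prabhakarKernel γ ρ μ ω y| * Real.exp ((n : ℝ) * (t - y)) =
      |prabhakarKernel γ ρ μ ω y| * Real.exp (-((n : ℝ) * y)) * Real.exp (n * t) := fun y => by
    rw [mul_assoc, ← Real.exp_add]; ring_nf
  simp only [hfac]
  rw [intervalIntegral.integral_mul_const]
  gcongr
  refine le_trans ?_ hn.le
  exact intervalIntegral.integral_mono_interval le_rfl ht.1 ht.2
    (.of_forall fun y => by positivity) (hi.mul_continuousOn (hexp n))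

theorem abs_integral_prabhakarKernel_mul_le {ρ μ b ε s M : ℝ} (hρ : 0 < ρ) (hμ : 0 < μ)
    (γ ω : ℝ) (hs : ∀ t ∈ Set.Icc 0 b,
      ∫ y in (0 : ℝ)..t, |prabhakarKernel γ ρ μ ω (t - y)| * Real.exp (s * y) ≤
        ε * Real.exp (s * t)) (hM : 0 ≤ M) {u : ℝ → ℝ}
    (hu : ∀ y ∈ Set.Icc 0 b, |u y| ≤ M * Real.exp (s * y)) {t : ℝ} (ht : t ∈ Set.Icc 0 b) :
    |∫ y in (0 : ℝ)..t, prabhakarKernel γ ρ μ ω (t - y) * u y| ≤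
      M * ε * Real.exp (s * t) := by
  have hi : IntervalIntegrable (fun y => M * (|prabhakarKernel γ ρ μ ω (t - y)| *
      Real.exp (s * y))) volume 0 t :=
    ((intervalIntegrable_prabhakarKernel_sub hρ hμ γ ω ht.1).abs.mul_continuousOn
      (by fun_prop)).const_mul _
  have h1 := intervalIntegral.norm_integral_le_of_norm_le ht.1 (.of_forall fun y hy => ?_) hi
    (f := fun y => prabhakarKernel γ ρ μ ω (t - y) * u y)
  · refine h1.trans ?_
    rw [intervalIntegral.integral_const_mul, mul_assoc]
    gcongr
    exact hs t ht
  · rw [norm_mul, Real.norm_eq_abs, Real.norm_eq_abs, mul_left_comm]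
    gcongr
    exact hu y ⟨hy.1.le, hy.2.trans ht.2⟩

/-- The homogeneous Volterra equation has only the zero solution. -/
theorem volterra_eq_zero {ρ μ a t : ℝ} (hρ : 0 < ρ) (hμ : 0 < μ) (γ ω : ℝ) (ht : 0 ≤ t)
    {u : ℝ → ℝ} (hc : ContinuousOn u (Set.Icc 0 t))
    (hu : ∀ x ∈ Set.Icc 0 t,
      u x = a * ∫ y in (0 : ℝ)..x, prabhakarKernel γ ρ μ ω (x - y) * u y) : u t = 0 := by
  -- With this `ε`, each use of the equation halves the weighted bound on `u`; the `+ 1` allows `a =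
  -- 0`.
  obtain ⟨s, hs0, hs⟩ := exists_integral_abs_prabhakarKernel_exp_le hρ hμ γ ω ht
    (by positivity : 0 < (2 * (|a| + 1))⁻¹)
  obtain ⟨M, hM⟩ := isCompact_Icc.exists_bound_of_continuousOn hc
  have hM0 : 0 ≤ M := (norm_nonneg _).trans (hM t ⟨ht, le_rfl⟩)
  have hn : ∀ n : ℕ, ∀ x ∈ Set.Icc 0 t, |u x| ≤ M * (1 / 2) ^ n * Real.exp (s * x) := by
    intro n
    induction n with
    | zero =>
      intro x hx
      have : 1 ≤ Real.exp (s * x) := Real.one_le_exp (mul_nonneg hs0 hx.1)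
      have := hM x hx
      rw [Real.norm_eq_abs] at this
      nlinarith
    | succ n ih =>
      intro x hx
      have h1 := abs_integral_prabhakarKernel_mul_le hρ hμ γ ω hs (by positivity) ih hx
      rw [hu x hx, abs_mul]
      calc _ ≤ (|a| + 1) *
            (M * (1 / 2) ^ n * (2 * (|a| + 1))⁻¹ * Real.exp (s * x)) := by
            gcongr; linarith
        _ = _ := by
            have : |a| + 1 ≠ 0 := by positivity
            field_simp
            ring
  have hlim : Filter.Tendsto (fun n : ℕ => M * (1 / 2 : ℝ) ^ n * Real.exp (s * t)) Filter.atTop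
      (nhds (M * 0 * Real.exp (s * t))) :=
    ((tendsto_pow_atTop_nhds_zero_of_lt_one (by norm_num) (by norm_num)).const_mul M).mul_const _
  have := ge_of_tendsto' hlim fun n => hn n t ⟨ht, le_rfl⟩
  simp only [mul_zero, zero_mul] at this
  exact abs_eq_zero.1 (le_antisymm this (abs_nonneg _))

/-- Two continuous solutions of the same linear Volterra equation coincide. -/
theorem volterra_unique {ρ μ a c : ℝ} (hρ : 0 < ρ) (hμ : 0 < μ) (γ ω : ℝ)
    {f f' h : ℝ → ℝ} (hf : ∀ b, 0 ≤ b → ContinuousOn f (Set.Icc 0 b))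
    (hf' : ∀ b, 0 ≤ b → ContinuousOn f' (Set.Icc 0 b))
    (hh : ∀ b, 0 ≤ b → ContinuousOn h (Set.Icc 0 b))
    (hfe : ∀ t, 0 ≤ t →
      f t = c + ∫ y in (0 : ℝ)..t, prabhakarKernel γ ρ μ ω (t - y) * (a * f y + h y))
    (hfe' : ∀ t, 0 ≤ t →
      f' t = c + ∫ y in (0 : ℝ)..t, prabhakarKernel γ ρ μ ω (t - y) * (a * f' y + h y))
    {t : ℝ} (ht : 0 ≤ t) : f t = f' t := by
  refine sub_eq_zero.1 (volterra_eq_zero (a := a) hρ hμ γ ω ht (u := fun t => f t - f' t)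
    ((hf t ht).sub (hf' t ht)) fun x hx => ?_)
  have i1 := intervalIntegrable_prabhakarKernel_sub_mul hρ hμ γ ω hx.1
    (f := fun y => a * f y + h y) (((hf x hx.1).const_mul a).add (hh x hx.1))
  have i2 := intervalIntegrable_prabhakarKernel_sub_mul hρ hμ γ ω hx.1
    (f := fun y => a * f' y + h y) (((hf' x hx.1).const_mul a).add (hh x hx.1))
  rw [hfe x hx.1, hfe' x hx.1, add_sub_add_left_eq_sub, ← intervalIntegral.integral_sub i1 i2,
    ← intervalIntegral.integral_const_mul]
  refine intervalIntegral.integral_congr fun y _ => ?_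
  ring
-- Iterated kernels and their series
theorem integrable_tsum_of_summable_integral_norm {α : Type*} {mα : MeasurableSpace α}
    {m : Measure α} {F : ℕ → α → ℝ} (hF : ∀ i, Integrable (F i) m)
    (hs : Summable fun i => ∫ a, ‖F i a‖ ∂m) : Integrable (fun a => ∑' i, F i a) m := by
  have hfin : ∑' i, ∫⁻ a, ‖F i a‖ₑ ∂m ≠ ⊤ := by
    have e : ∀ i, ∫⁻ a, ‖F i a‖ₑ ∂m = ENNReal.ofReal (∫ a, ‖F i a‖ ∂m) := fun i =>
      (ofReal_integral_norm_eq_lintegral_enorm (hF i)).symm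
    simp only [e]
    exact hs.tsum_ofReal_ne_top
  have hlin : ∫⁻ a, ∑' i, ‖F i a‖ₑ ∂m ≠ ⊤ := by
    rwa [lintegral_tsum fun i => (hF i).aestronglyMeasurable.enorm]
  have hae : ∀ᵐ a ∂m, ∑' i, ‖F i a‖ₑ < ⊤ :=
    ae_lt_top' (AEMeasurable.tsum fun i => (hF i).aestronglyMeasurable.enorm) hlin
  refine ⟨?_, ?_⟩
  · refine aestronglyMeasurable_of_tendsto_ae (u := Filter.atTop)
      (f := fun n a => ∑ i ∈ Finset.range n, F i a) (fun n => ?_) ?_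
    · exact Finset.aestronglyMeasurable_fun_sum _ fun i _ => (hF i).aestronglyMeasurable
    · filter_upwards [hae] with a ha
      have : Summable fun i => F i a := by
        refine Summable.of_norm ?_
        have h2 : Summable fun i => ‖F i a‖₊ := by
          rw [← ENNReal.tsum_coe_ne_top_iff_summable]
          exact ha.ne
        exact NNReal.summable_coe.2 h2
      exact this.hasSum.tendsto_sum_nat
  · exact (lintegral_mono fun a => enorm_tsum_le_tsum_enorm).trans_lt hlin.lt_top

/-- `t^{μr} E^{γr}_{ρ,μr+1}(ω t^ρ)`. -/
noncomputable def prabhakarPower (γ ρ μ ω : ℝ) (r : ℕ) : ℝ → ℝ :=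
  prabhakarKernel (γ * r) ρ (μ * r + 1) ω

theorem prabhakarPower_eq {γ ρ μ ω t : ℝ} (ht : 0 ≤ t) (r : ℕ) :
    prabhakarPower γ ρ μ ω r t = (t ^ μ) ^ r * prabhakarML (γ * r) ρ (μ * r + 1) (ω * t ^ ρ) := by
  rw [prabhakarPower, prabhakarKernel, add_sub_cancel_right, Real.rpow_mul_natCast ht]

theorem prabhakarPower_zero (γ ρ μ ω t : ℝ) : prabhakarPower γ ρ μ ω 0 t = 1 := by
  simp [prabhakarPower, prabhakarKernel_zero_one]

theorem prabhakarPower_succ_zero {μ : ℝ} (hμ : 0 < μ) (γ ρ ω : ℝ) (r : ℕ) :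
    prabhakarPower γ ρ μ ω (r + 1) 0 = 0 := by
  rw [prabhakarPower_eq le_rfl, Real.zero_rpow hμ.ne', zero_pow (Nat.succ_ne_zero r), zero_mul]

section

variable {γ ρ μ : ℝ} (hρ : 0 < ρ) (hμ : 0 < μ)
include hρ hμ

theorem continuous_prabhakarPower (γ ω : ℝ) (r : ℕ) : Continuous (prabhakarPower γ ρ μ ω r) :=
  continuous_prabhakarKernel hρ (le_add_of_nonneg_left (by positivity)) _ _

/-- By the semigroup law these functions are the iterates of convolution with the kernel, starting
from the constant 1. -/
theorem prabhakarPower_succ (γ ω : ℝ) (r : ℕ) {t : ℝ} (ht : 0 ≤ t) :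
    prabhakarPower γ ρ μ ω (r + 1) t =
      ∫ y in (0 : ℝ)..t, prabhakarKernel γ ρ μ ω (t - y) * prabhakarPower γ ρ μ ω r y := by
  rcases ht.eq_or_lt with rfl | ht
  · simp [prabhakarPower_succ_zero hμ]
  rw [prabhakarPower, prabhakarPower, integral_prabhakarKernel_mul hρ hμ (by positivity) _ _ _ ht]
  congr 1 <;> · push_cast; ring

theorem prabhakarPower_succ_eq_integral (γ ω : ℝ) (r : ℕ) {t : ℝ} (ht : 0 ≤ t) :
    prabhakarPower γ ρ μ ω (r + 1) t =
      ∫ y in (0 : ℝ)..t, prabhakarKernel (γ * (r + 1 : ℕ)) ρ (μ * (r + 1 : ℕ)) ω y := by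
  rcases ht.eq_or_lt with rfl | ht
  · simp [prabhakarPower_succ_zero hμ]
  rw [prabhakarPower, integral_prabhakarKernel hρ (by positivity) _ _ ht]

/-- In the exponentially weighted norm each convolution costs a factor `ε`; on `[0,b]` the weight is
at most `exp(s b)`. -/
theorem exists_abs_prabhakarPower_le (γ ω : ℝ) {b ε : ℝ} (hb : 0 ≤ b) (hε : 0 < ε) :
    ∃ C, 0 ≤ C ∧ ∀ r : ℕ, ∀ t ∈ Set.Icc 0 b, |prabhakarPower γ ρ μ ω r t| ≤ C * ε ^ r := by
  obtain ⟨s, hs0, hs⟩ := exists_integral_abs_prabhakarKernel_exp_le hρ hμ γ ω hb hε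
  have hr : ∀ r : ℕ, ∀ t ∈ Set.Icc 0 b,
      |prabhakarPower γ ρ μ ω r t| ≤ ε ^ r * Real.exp (s * t) := by
    intro r
    induction r with
    | zero =>
      intro t ht
      rw [prabhakarPower_zero, abs_one, pow_zero, one_mul]
      exact Real.one_le_exp (mul_nonneg hs0 ht.1)
    | succ r ih =>
      intro t ht
      rw [prabhakarPower_succ hρ hμ γ ω r ht.1, pow_succ]
      exact abs_integral_prabhakarKernel_mul_le hρ hμ γ ω hs (by positivity) ih ht
  refine ⟨Real.exp (s * b), by positivity, fun r t ht => (hr r t ht).trans ?_⟩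
  rw [mul_comm]
  have := ht.2
  gcongr

variable {a : ℕ → ℝ} {A B : ℝ} (ha : ∀ r, |a r| ≤ A * B ^ r)
include ha

theorem exists_abs_mul_prabhakarPower_le (hB : 0 < B) (γ ω : ℝ) {b : ℝ} (hb : 0 ≤ b) :
    ∃ C, 0 ≤ C ∧ ∀ r : ℕ, ∀ t ∈ Set.Icc 0 b,
      |a r| * |prabhakarPower γ ρ μ ω r t| ≤ C * (1 / 2) ^ r := by
  have hA : 0 ≤ A := by simpa using (abs_nonneg _).trans (ha 0)
  obtain ⟨C, hC, h⟩ := exists_abs_prabhakarPower_le hρ hμ γ ω hb (by positivity : 0 < (2 * B)⁻¹)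
  refine ⟨A * C, by positivity, fun r t ht => ?_⟩
  calc _ ≤ (A * B ^ r) * (C * (2 * B)⁻¹ ^ r) := by
        gcongr
        · exact ha r
        · exact h r t ht
    _ = A * C * (B * (2 * B)⁻¹) ^ r := by rw [mul_pow B]; ring
    _ = _ := by congr 2; field_simp

theorem summable_mul_prabhakarPower (hB : 0 < B) (γ ω : ℝ) {t : ℝ} (ht : 0 ≤ t) :
    Summable fun r => a r * prabhakarPower γ ρ μ ω r t := by
  obtain ⟨C, _, h⟩ := exists_abs_mul_prabhakarPower_le hρ hμ ha hB γ ω ht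
  refine Summable.of_norm_bounded
    ((summable_geometric_of_lt_one (by norm_num) (by norm_num : (1 / 2 : ℝ) < 1)).mul_left C)
    fun r => ?_
  rw [norm_mul]
  exact h r t ⟨ht, le_rfl⟩

theorem tsum_mul_prabhakarPower_succ (hB : 0 < B) (γ ω : ℝ) {t : ℝ} (ht : 0 ≤ t) :
    ∫ y in (0 : ℝ)..t, prabhakarKernel γ ρ μ ω (t - y) *
        ∑' r, a r * prabhakarPower γ ρ μ ω r y =
      ∑' r, a r * prabhakarPower γ ρ μ ω (r + 1) t := by
  obtain ⟨C, hC, h⟩ := exists_abs_mul_prabhakarPower_le hρ hμ ha hB γ ω ht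
  have hk := intervalIntegrable_prabhakarKernel_sub hρ hμ γ ω ht
  have hi : ∀ r, IntervalIntegrable (fun y => a r * (prabhakarKernel γ ρ μ ω (t - y) *
      prabhakarPower γ ρ μ ω r y)) volume 0 t := fun r =>
    (hk.mul_continuousOn (continuous_prabhakarPower hρ hμ γ ω r).continuousOn).const_mul _
  have hgeo : Summable fun r : ℕ => (1 / 2 : ℝ) ^ r :=
    summable_geometric_of_lt_one (by norm_num) (by norm_num)
  have hsum : Summable fun r => ∫ y in Set.Ioc 0 t, ‖a r * (prabhakarKernel γ ρ μ ω (t - y) *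
      prabhakarPower γ ρ μ ω r y)‖ := by
    refine Summable.of_nonneg_of_le (fun r => integral_nonneg fun _ => norm_nonneg _) (fun r => ?_)
      (hgeo.mul_left (C * ∫ y in (0 : ℝ)..t, |prabhakarKernel γ ρ μ ω (t - y)|))
    rw [mul_right_comm, ← intervalIntegral.integral_const_mul, ← intervalIntegral.integral_of_le ht]
    refine intervalIntegral.integral_mono_on ht (hi r).norm (hk.abs.const_mul _) fun y hy => ?_
    rw [norm_mul, norm_mul, Real.norm_eq_abs, Real.norm_eq_abs, Real.norm_eq_abs,
      mul_left_comm, mul_comm (C * _)]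
    exact mul_le_mul_of_nonneg_left (h r y hy) (abs_nonneg _)
  have key := integral_tsum_of_summable_integral_norm (fun r => (hi r).1) hsum
  rw [intervalIntegral.integral_of_le ht]
  calc _ = ∫ y in Set.Ioc 0 t, ∑' r, a r * (prabhakarKernel γ ρ μ ω (t - y) *
          prabhakarPower γ ρ μ ω r y) := by
        congr 1; funext y
        rw [← tsum_mul_left]
        exact tsum_congr fun r => by ring
    _ = _ := by
        rw [← key]
        refine tsum_congr fun r => ?_
        rw [prabhakarPower_succ hρ hμ γ ω r ht, ← intervalIntegral.integral_of_le ht,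
          intervalIntegral.integral_const_mul]

/-- The series is a constant plus the integral of the termwise derivatives, once these are summable
in `L¹`. Their absolute values are dominated by kernels with `|ω|`, whose integrals are the iterates
for `|ω|`; `γ ≥ 0` keeps the parameter `γ(r+1)` unchanged in this majorant. -/
theorem absolutelyContinuousOnInterval_tsum_mul_prabhakarPower (hB : 0 < B) (hγ : 0 ≤ γ) (ω : ℝ)
    {b : ℝ} (hb : 0 ≤ b) :
    AbsolutelyContinuousOnInterval (fun t => ∑' r, a r * prabhakarPower γ ρ μ ω r t) 0 b := by
  set w : ℕ → ℝ → ℝ := fun r y =>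
    a (r + 1) * prabhakarKernel (γ * (r + 1 : ℕ)) ρ (μ * (r + 1 : ℕ)) ω y with hw
  have hpos : ∀ r : ℕ, 0 < μ * (r + 1 : ℕ) := fun r => by positivity
  have hi : ∀ t, 0 ≤ t → ∀ r, IntervalIntegrable (w r) volume 0 t := fun t ht r =>
    (intervalIntegrable_prabhakarKernel hρ (hpos r) _ ω ht).const_mul _
  have hsum : ∀ t, 0 ≤ t → Summable fun r => ∫ y in Set.Ioc 0 t, ‖w r y‖ := by
    intro t ht
    obtain ⟨C, hC, h⟩ := exists_abs_mul_prabhakarPower_le hρ hμ ha hB γ |ω| ht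
    have hgeo : Summable fun r : ℕ => C * (1 / 2 : ℝ) ^ (r + 1) :=
      ((summable_nat_add_iff 1).2
        (summable_geometric_of_lt_one (by norm_num) (by norm_num))).mul_left _
    refine Summable.of_nonneg_of_le (fun r => integral_nonneg fun _ => norm_nonneg _) (fun r => ?_)
      hgeo
    refine le_trans ?_ (h (r + 1) t ⟨ht, le_rfl⟩)
    refine le_trans ?_ (mul_le_mul_of_nonneg_left (le_abs_self _) (abs_nonneg _))
    rw [prabhakarPower_succ_eq_integral hρ hμ γ |ω| r ht, ← intervalIntegral.integral_const_mul,
      ← intervalIntegral.integral_of_le ht]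
    refine intervalIntegral.integral_mono_on_of_le_Ioo ht (hi t ht r).norm
      ((intervalIntegrable_prabhakarKernel hρ (hpos r) _ _ ht).const_mul _) fun y hy => ?_
    rw [hw, norm_mul, Real.norm_eq_abs, Real.norm_eq_abs]
    have h1 := abs_prabhakarKernel_le hρ (hpos r) (γ * (r + 1 : ℕ)) ω hy.1
    rw [abs_of_nonneg (by positivity : 0 ≤ γ * (r + 1 : ℕ))] at h1
    gcongr
  have hint : IntervalIntegrable (fun y => ∑' r, w r y) volume 0 b := by
    rw [intervalIntegrable_iff_integrableOn_Ioc_of_le hb]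
    exact integrable_tsum_of_summable_integral_norm (fun r => (hi b hb r).1) (hsum b hb)
  refine ((absolutelyContinuousOnInterval_const (a 0) 0 b).add
    (hint.absolutelyContinuousOnInterval_intervalIntegral (c := 0) (by simp))).congr_uIcc
    fun t ht => ?_
  rw [Set.uIcc_of_le hb] at ht
  rw [(summable_mul_prabhakarPower hρ hμ ha hB γ ω ht.1).tsum_eq_zero_add, prabhakarPower_zero,
    mul_one, Pi.add_apply, intervalIntegral.integral_of_le ht.1,
    ← integral_tsum_of_summable_integral_norm (fun r => (hi t ht.1 r).1) (hsum t ht.1)]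
  congr 1
  refine tsum_congr fun r => ?_
  rw [prabhakarPower_succ_eq_integral hρ hμ γ ω r ht.1, ← intervalIntegral.integral_of_le ht.1,
    intervalIntegral.integral_const_mul]

end
-- Coefficients of the state probabilities
/-- The coefficient of `t^{μr} E^{γr}_{ρ,μr+1}(-φ t^ρ)` in the series for the `k`-th state
probability. -/
def stateCoeff (lam : ℝ) (k r : ℕ) : ℝ := (-1) ^ (r - k) * (r.choose k : ℝ) * lam ^ r

theorem stateCoeff_of_lt (lam : ℝ) {k r : ℕ} (h : r < k) : stateCoeff lam k r = 0 := by
  simp [stateCoeff, Nat.choose_eq_zero_of_lt h]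

theorem stateCoeff_zero_right (lam : ℝ) (k : ℕ) :
    stateCoeff lam k 0 = if k = 0 then 1 else 0 := by
  cases k <;> simp [stateCoeff]

theorem stateCoeff_zero_succ (lam : ℝ) (r : ℕ) :
    stateCoeff lam 0 (r + 1) = -lam * stateCoeff lam 0 r := by
  simp [stateCoeff, pow_succ]; ring

/-- Pascal's rule: the coefficient form of the `k`-th state equation. -/
theorem stateCoeff_succ_succ (lam : ℝ) (k r : ℕ) :
    stateCoeff lam (k + 1) (r + 1) = -lam * stateCoeff lam (k + 1) r + lam * stateCoeff lam k r := by
  rcases lt_trichotomy r k with h | rfl | h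
  · rw [stateCoeff_of_lt _ h, stateCoeff_of_lt _ (by omega : r < k + 1),
      stateCoeff_of_lt _ (by omega : r + 1 < k + 1)]
    ring
  · simp [stateCoeff, pow_succ]; ring
  · obtain ⟨n, rfl⟩ := Nat.exists_eq_add_of_lt h
    have e1 : k + n + 1 + 1 - (k + 1) = n + 1 := by omega
    have e2 : k + n + 1 - (k + 1) = n := by omega
    have e3 : k + n + 1 - k = n + 1 := by omega
    simp only [stateCoeff, e1, e2, e3, Nat.choose_succ_succ (k + n + 1) k, pow_succ]
    push_cast
    ring

theorem abs_stateCoeff {lam : ℝ} (hlam : 0 < lam) (k r : ℕ) :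
    |stateCoeff lam k r| = (r.choose k : ℝ) * lam ^ r := by
  rw [stateCoeff, abs_mul, abs_mul, abs_pow, abs_neg, abs_one, one_pow, one_mul, Nat.abs_cast,
    abs_of_pos (pow_pos hlam r)]

theorem abs_stateCoeff_le {lam : ℝ} (hlam : 0 < lam) (k r : ℕ) :
    |stateCoeff lam k r| ≤ 1 * (2 * lam) ^ r := by
  rw [abs_stateCoeff hlam, one_mul, mul_pow]
  gcongr
  exact_mod_cast Nat.choose_le_two_pow r k

theorem sum_pow_mul_stateCoeff (lam v : ℝ) (r : ℕ) :
    ∑ k ∈ Finset.range (r + 1), v ^ k * stateCoeff lam k r = (-lam * (1 - v)) ^ r := by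
  have : -lam * (1 - v) = (v + -1) * lam := by ring
  rw [this, mul_pow, add_pow, Finset.sum_mul]
  refine Finset.sum_congr rfl fun k _ => ?_
  rw [stateCoeff]; ring

/-- Absorbing `k` into the binomial coefficient leaves a multiple of `(1 - 1)^{r-1}`, so only `r =
1` survives. -/
theorem sum_natCast_mul_stateCoeff (lam : ℝ) (r : ℕ) :
    ∑ k ∈ Finset.range (r + 1), (k : ℝ) * stateCoeff lam k r = if r = 1 then lam else 0 := by
  cases r with
  | zero => simp
  | succ n =>
    rw [Finset.sum_range_succ', Nat.cast_zero, zero_mul, add_zero]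
    have e : ∀ j ∈ Finset.range (n + 1), ((j + 1 : ℕ) : ℝ) * stateCoeff lam (j + 1) (n + 1) =
        (n + 1) * lam ^ (n + 1) * (1 ^ j * (-1) ^ (n - j) * (n.choose j : ℝ)) := by
      intro j _
      have hc : ((n + 1 : ℕ) : ℝ) * (n.choose j : ℝ) =
          ((n + 1).choose (j + 1) : ℝ) * ((j + 1 : ℕ) : ℝ) := by
        exact_mod_cast Nat.add_one_mul_choose_eq n j
      push_cast at hc
      rw [stateCoeff, Nat.add_sub_add_right, one_pow]
      push_cast
      linear_combination (-(-1) ^ (n - j) * lam ^ (n + 1)) * hc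
    rw [Finset.sum_congr rfl e, ← Finset.mul_sum, ← add_pow]
    cases n <;> simp

/-- The weights `2^k` cover both `v^k` and `k`, and `∑ 2^k (r choose k) = 3^r` is still geometric.
-/
theorem sum_abs_mul_stateCoeff_le {lam : ℝ} (hlam : 0 < lam) {x : ℕ → ℝ}
    (hx : ∀ k, |x k| ≤ 2 ^ k) (r : ℕ) :
    ∑ k ∈ Finset.range (r + 1), |x k * stateCoeff lam k r| ≤ 1 * (3 * lam) ^ r := by
  calc _ ≤ ∑ k ∈ Finset.range (r + 1), 2 ^ k * ((r.choose k : ℝ) * lam ^ r) := by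
        refine Finset.sum_le_sum fun k _ => ?_
        rw [abs_mul, abs_stateCoeff hlam]
        have := hx k
        gcongr
    _ = (2 + 1) ^ r * lam ^ r := by
        rw [add_pow, Finset.sum_mul]
        exact Finset.sum_congr rfl fun k _ => by rw [one_pow]; ring
    _ = _ := by rw [one_mul, mul_pow]; norm_num

/-- The `+ 1` keeps the ratio positive when `x = 0`, that is, at `v = 1`. -/
theorem abs_pow_le_one_mul (x : ℝ) (r : ℕ) : |x ^ r| ≤ 1 * (|x| + 1) ^ r := by
  rw [abs_pow, one_mul]
  gcongr
  linarith

/-! ### Solution of the Cauchy problem and of the state system -/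

section

variable {γ ρ μ : ℝ} (hγ : 0 ≤ γ) (hρ : 0 < ρ) (hμ : 0 < μ) (hμ1 : μ ≤ 1)
  (hγμ : γ ≠ 0 → μ < 1)

theorem pgfTerm_eq (φ lam v : ℝ) {t : ℝ} (ht : 0 ≤ t) (r : ℕ) :
    pgfTerm γ μ ρ φ lam v t r =
      (-lam * (1 - v)) ^ r * prabhakarPower γ ρ μ (-φ) r t := by
  rw [pgfTerm, prabhakarPower_eq ht, mul_pow, mul_pow]; ring

theorem pgfSeries_eq (φ lam v : ℝ) {t : ℝ} (ht : 0 ≤ t) :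
    pgfSeries γ μ ρ φ lam v t =
      ∑' r, (-lam * (1 - v)) ^ r * prabhakarPower γ ρ μ (-φ) r t :=
  tsum_congr fun r => pgfTerm_eq φ lam v ht r

theorem stateTerm_eq (φ lam : ℝ) (k : ℕ) {t : ℝ} (ht : 0 ≤ t) (r : ℕ) :
    stateTerm γ μ ρ φ lam k t r = stateCoeff lam k r * prabhakarPower γ ρ μ (-φ) r t := by
  rw [stateTerm, stateCoeff, prabhakarPower_eq ht, mul_pow]; ring

theorem stateSeries_eq (φ lam : ℝ) (k : ℕ) {t : ℝ} (ht : 0 ≤ t) :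
    stateSeries γ μ ρ φ lam k t =
      ∑' r, stateCoeff lam k r * prabhakarPower γ ρ μ (-φ) r t := by
  rw [stateSeries, tsum_subtype_eq_of_support_subset (f := stateTerm γ μ ρ φ lam k t)]
  · exact tsum_congr fun r => stateTerm_eq φ lam k ht r
  · intro r hr
    by_contra h
    exact hr (by rw [stateTerm_eq φ lam k ht, stateCoeff_of_lt _ (not_le.1 h), zero_mul])

theorem meanFormula_eq (φ lam : ℝ) {t : ℝ} (ht : 0 ≤ t) :
    meanFormula γ μ ρ φ lam t = lam * prabhakarPower γ ρ μ (-φ) 1 t := by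
  rw [meanFormula, prabhakarPower_eq ht]
  simp [add_comm, mul_assoc]

include hγ hρ hμ hμ1 hγμ

/-- A series in the functions `t^{μr} E^{γr}_{ρ,μr+1}(ω t^ρ)` solves the Cauchy problem whose
right-hand side has the shifted coefficients. -/
theorem isCauchySolution_tsum {a : ℕ → ℝ} {A B : ℝ} (ha : ∀ r, |a r| ≤ A * B ^ r) (hB : 0 < B)
    (ω : ℝ) : IsCauchySolution γ μ ρ ω (fun t => ∑' r, a r * prabhakarPower γ ρ μ ω r t) (a 0)
      (fun t => ∑' r, a (r + 1) * prabhakarPower γ ρ μ ω r t) ∧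
    ∀ b > 0, AbsolutelyContinuousOnInterval
      (fun t => ∑' r, a (r + 1) * prabhakarPower γ ρ μ ω r t) 0 b := by
  have ha' : ∀ r, |a (r + 1)| ≤ (A * B) * B ^ r := fun r => (ha (r + 1)).trans_eq (by ring)
  have hac : ∀ b > 0, AbsolutelyContinuousOnInterval
      (fun t => ∑' r, a (r + 1) * prabhakarPower γ ρ μ ω r t) 0 b := fun b hb =>
    absolutelyContinuousOnInterval_tsum_mul_prabhakarPower hρ hμ ha' hB hγ ω hb.le
  refine ⟨.of_volterra hρ hμ hμ1 hγμ hac fun t ht => ?_, hac⟩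
  rw [(summable_mul_prabhakarPower hρ hμ ha hB γ ω ht).tsum_eq_zero_add, prabhakarPower_zero,
    mul_one, tsum_mul_prabhakarPower_succ hρ hμ ha' hB γ ω ht]

theorem isCauchySolution_pgfSeries (φ lam v : ℝ) :
    IsCauchySolution γ μ ρ (-φ) (pgfSeries γ μ ρ φ lam v) 1
      (fun t => -lam * (1 - v) * pgfSeries γ μ ρ φ lam v t) := by
  have h := isCauchySolution_tsum hγ hρ hμ hμ1 hγμ (abs_pow_le_one_mul (-lam * (1 - v)))
    (by positivity) (-φ)
  rw [pow_zero] at h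
  refine h.1.congr hρ hμ hμ1 hγμ h.2 (fun t ht => (pgfSeries_eq φ lam v ht).symm) fun t ht => ?_
  rw [pgfSeries_eq φ lam v ht, ← tsum_mul_left]
  exact tsum_congr fun r => by ring

theorem solvesStateSystem_stateSeries (φ : ℝ) {lam : ℝ} (hlam : 0 < lam) :
    SolvesStateSystem γ μ ρ φ lam (stateSeries γ μ ρ φ lam) := by
  intro k
  have h := isCauchySolution_tsum hγ hρ hμ hμ1 hγμ (abs_stateCoeff_le hlam k) (by positivity) (-φ)
  rw [stateCoeff_zero_right] at h
  refine h.1.congr hρ hμ hμ1 hγμ h.2 (fun t ht => (stateSeries_eq φ lam k ht).symm) fun t ht => ?_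
  have hs := fun k => summable_mul_prabhakarPower hρ hμ (abs_stateCoeff_le hlam k) (by positivity)
    γ (-φ) ht
  cases k with
  | zero =>
    rw [stateRHS, stateSeries_eq φ lam 0 ht, ← tsum_mul_left]
    exact tsum_congr fun r => by rw [stateCoeff_zero_succ]; ring
  | succ k =>
    rw [stateRHS, stateSeries_eq φ lam _ ht, stateSeries_eq φ lam _ ht, ← tsum_mul_left,
      ← tsum_mul_left, ← ((hs (k + 1)).mul_left _).tsum_add ((hs k).mul_left _)]
    exact tsum_congr fun r => by rw [stateCoeff_succ_succ]; ring

omit hγ in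
theorem eq_of_isCauchySolutionAE {a c ω : ℝ} {f f' h : ℝ → ℝ}
    (hh : ∀ b, 0 < b → AbsolutelyContinuousOnInterval h 0 b)
    (hf : IsCauchySolutionAE γ μ ρ ω f c (fun t => a * f t + h t))
    (hf' : IsCauchySolutionAE γ μ ρ ω f' c (fun t => a * f' t + h t)) {t : ℝ} (ht : 0 ≤ t) :
    f t = f' t := by
  have hc : ∀ {g : ℝ → ℝ}, (∀ b, 0 < b → AbsolutelyContinuousOnInterval g 0 b) →
      ∀ b, 0 ≤ b → ContinuousOn g (Set.Icc 0 b) := by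
    intro g hg b hb
    -- The larger interval covers `b = 0`, since absolute continuity is given only for positive
    -- endpoints.
    have := (hg (b + 1) (by linarith)).continuousOn
    rw [Set.uIcc_of_le (by linarith)] at this
    exact this.mono (Set.Icc_subset_Icc_right (by linarith))
  exact volterra_unique hρ hμ γ ω (hc hf.absCont) (hc hf'.absCont) (hc hh)
    (fun t ht => hf.volterra hρ hμ hμ1 hγμ ht) (fun t ht => hf'.volterra hρ hμ hμ1 hγμ ht) ht

theorem eq_pgfSeries_of_isCauchySolutionAE (φ lam v : ℝ) {f : ℝ → ℝ}
    (hf : IsCauchySolutionAE γ μ ρ (-φ) f 1 (fun t => -lam * (1 - v) * f t)) {t : ℝ}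
    (ht : 0 ≤ t) : f t = pgfSeries γ μ ρ φ lam v t := by
  have hG := isCauchySolution_pgfSeries hγ hρ hμ hμ1 hγμ φ lam v
  refine eq_of_isCauchySolutionAE hρ hμ hμ1 hγμ (a := -lam * (1 - v)) (h := fun _ => 0)
    (fun b _ => absolutelyContinuousOnInterval_const 0 0 b) (by simpa using hf) ?_ ht
  simpa using (⟨hG.absCont, hG.init, .of_forall hG.eqn⟩ : IsCauchySolutionAE γ μ ρ (-φ) _ _ _)

theorem eq_stateSeries_of_solvesStateSystemAE (φ : ℝ) {lam : ℝ} (hlam : 0 < lam)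
    {p : ℕ → ℝ → ℝ} (hp : SolvesStateSystemAE γ μ ρ φ lam p) (k : ℕ) :
    ∀ t, 0 ≤ t → p k t = stateSeries γ μ ρ φ lam k t := by
  have hS : SolvesStateSystemAE γ μ ρ φ lam (stateSeries γ μ ρ φ lam) := fun k =>
    have h := solvesStateSystem_stateSeries hγ hρ hμ hμ1 hγμ φ hlam k
    ⟨h.absCont, h.init, .of_forall h.eqn⟩
  induction k with
  | zero =>
    intro t ht
    refine eq_of_isCauchySolutionAE hρ hμ hμ1 hγμ (a := -lam) (c := 1)
      (ω := -φ) (h := fun _ => 0)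
      (fun b _ => absolutelyContinuousOnInterval_const 0 0 b) ?_ ?_ ht
    · simpa only [add_zero] using! hp 0
    · simpa only [add_zero] using! hS 0
  | succ k ih =>
    intro t ht
    -- The preceding state is a known forcing term; by induction it is the same for both solutions
    -- on `[0,∞)`.
    refine eq_of_isCauchySolutionAE hρ hμ hμ1 hγμ (a := -lam) (h := fun t => lam * p k t)
      (fun b hb => ((hp k).absCont b hb).const_mul lam) (hp (k + 1)) ?_ ht
    refine ⟨(hS (k + 1)).absCont, (hS (k + 1)).init, ?_⟩
    filter_upwards [(hS (k + 1)).eqn] with s hs hs0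
    rw [ih s hs0.le]
    exact hs hs0

omit hγ hμ1 hγμ

/-- Interchange of summation over pairs `(r, k)`: each row `r` is finite because the coefficients
vanish for `k > r`, and the rows of absolute values grow geometrically, which the decay of the
iterates outweighs. -/
theorem hasSum_mul_stateSeries (φ : ℝ) {lam : ℝ} (hlam : 0 < lam) {x : ℕ → ℝ}
    (hx : ∀ k, |x k| ≤ 2 ^ k) {t : ℝ} (ht : 0 ≤ t) :
    HasSum (fun k => x k * stateSeries γ μ ρ φ lam k t)
      (∑' r, (∑ k ∈ Finset.range (r + 1), x k * stateCoeff lam k r) *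
        prabhakarPower γ ρ μ (-φ) r t) := by
  set F : ℕ × ℕ → ℝ := fun q => x q.2 * stateCoeff lam q.2 q.1 * prabhakarPower γ ρ μ (-φ) q.1 t
    with hF
  have hzero : ∀ r, ∀ k ∉ Finset.range (r + 1), F (r, k) = 0 := fun r k hk => by
    rw [hF]
    simp only
    rw [stateCoeff_of_lt _ (by simpa using hk), mul_zero, zero_mul]
  have hrow : ∀ r, HasSum (fun k => F (r, k))
      ((∑ k ∈ Finset.range (r + 1), x k * stateCoeff lam k r) *
        prabhakarPower γ ρ μ (-φ) r t) := fun r => by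
    rw [Finset.sum_mul]
    exact hasSum_sum_of_ne_finset_zero (hzero r)
  have hrown : ∀ r, HasSum (fun k => ‖F (r, k)‖)
      ((∑ k ∈ Finset.range (r + 1), |x k * stateCoeff lam k r|) *
        |prabhakarPower γ ρ μ (-φ) r t|) := fun r => by
    have h := hasSum_sum_of_ne_finset_zero (f := fun k => ‖F (r, k)‖) (s := Finset.range (r + 1))
      (L := .unconditional ℕ) fun k hk => by rw [hzero r k hk, norm_zero]
    simpa only [hF, norm_mul _ (prabhakarPower _ _ _ _ _ _), Real.norm_eq_abs,
      ← Finset.sum_mul] using h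
  have hsum : Summable F := by
    refine Summable.of_norm ((summable_prod_of_nonneg fun q => norm_nonneg _).2
      ⟨fun r => (hrown r).summable, ?_⟩)
    simp only [fun r => (hrown r).tsum_eq]
    have hb : ∀ r, abs (∑ k ∈ Finset.range (r + 1), |x k * stateCoeff lam k r|) ≤
        1 * (3 * lam) ^ r := fun r => by
      rw [abs_of_nonneg (Finset.sum_nonneg fun _ _ => abs_nonneg _)]
      exact sum_abs_mul_stateCoeff_le hlam hx r
    have := (summable_mul_prabhakarPower hρ hμ hb (by positivity) γ (-φ) ht).norm
    refine this.congr fun r => ?_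
    rw [norm_mul, Real.norm_eq_abs, Real.norm_eq_abs,
      abs_of_nonneg (Finset.sum_nonneg fun _ _ => abs_nonneg _)]
  have hcol : ∀ k, HasSum (fun r => F (r, k)) (x k * stateSeries γ μ ρ φ lam k t) := fun k => by
    rw [stateSeries_eq φ lam k ht]
    simp only [hF, mul_assoc]
    exact (summable_mul_prabhakarPower hρ hμ (abs_stateCoeff_le hlam k) (by positivity)
      γ (-φ) ht).hasSum.mul_left _
  have h1 := hsum.hasSum.prod_fiberwise hrow
  rw [h1.tsum_eq]
  exact ((Equiv.prodComm ℕ ℕ).hasSum_iff.2 hsum.hasSum).prod_fiberwise hcol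

theorem hasSum_pow_mul_stateSeries (φ : ℝ) {lam v : ℝ} (hlam : 0 < lam) (hv : |v| ≤ 1) {t : ℝ}
    (ht : 0 ≤ t) :
    HasSum (fun k => v ^ k * stateSeries γ μ ρ φ lam k t) (pgfSeries γ μ ρ φ lam v t) := by
  have hx : ∀ k : ℕ, |v ^ k| ≤ 2 ^ k := fun k => by
    rw [abs_pow]
    gcongr
    linarith
  simpa only [pgfSeries_eq φ lam v ht, sum_pow_mul_stateCoeff] using
    hasSum_mul_stateSeries hρ hμ φ hlam hx ht

theorem hasSum_natCast_mul_stateSeries (φ : ℝ) {lam : ℝ} (hlam : 0 < lam) {t : ℝ}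
    (ht : 0 ≤ t) :
    HasSum (fun k : ℕ => (k : ℝ) * stateSeries γ μ ρ φ lam k t)
      (meanFormula γ μ ρ φ lam t) := by
  have hx : ∀ k : ℕ, |(k : ℝ)| ≤ 2 ^ k := fun k => by
    rw [Nat.abs_cast]
    exact_mod_cast Nat.lt_two_pow_self.le
  have h := hasSum_mul_stateSeries (γ := γ) hρ hμ φ hlam hx ht
  simp only [sum_natCast_mul_stateCoeff] at h
  rw [tsum_eq_single 1 fun r hr => by rw [if_neg hr, zero_mul], if_pos rfl,
    ← meanFormula_eq φ lam ht] at h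
  exact h

end

/-! ### Expectations and the main theorem -/

/-- The expectation of a function of a random variable with values in `ℕ`. -/
theorem integrable_and_hasSum_integral_comp_nat {Ω : Type*} [MeasurableSpace Ω] (P : Measure Ω)
    [IsProbabilityMeasure P] {N : Ω → ℕ} (hN : Measurable N) {x : ℕ → ℝ}
    (hx : Summable fun k => |x k| * P.real {ω | N ω = k}) :
    Integrable (fun ω => x (N ω)) P ∧
      HasSum (fun k => x k * P.real {ω | N ω = k}) (∫ ω, x (N ω) ∂P) := by
  set s : ℕ → Set Ω := fun k => {ω | N ω = k} with hs
  have hsm : ∀ k, MeasurableSet (s k) := fun k => hN (measurableSet_singleton k)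
  have hsd : Pairwise (Function.onFun Disjoint s) := fun i j hij =>
    Set.disjoint_left.2 fun ω hi hj => hij (hi.symm.trans hj)
  have hsu : ⋃ k, s k = Set.univ := Set.eq_univ_of_forall fun ω => Set.mem_iUnion.2 ⟨N ω, rfl⟩
  have hval : ∀ g : ℕ → ℝ, ∀ k, ∫ ω in s k, g (N ω) ∂P = g k * P.real (s k) := fun g k => by
    rw [setIntegral_congr_fun (g := fun _ => g k) (hsm k) fun ω hω => congrArg g hω,
      setIntegral_const, smul_eq_mul, mul_comm]
  have hon : ∀ k, IntegrableOn (fun ω => x (N ω)) (s k) P := fun k =>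
    (integrableOn_const (C := x k) (measure_ne_top _ _)).congr_fun
      (fun ω hω => congrArg x (Eq.symm hω)) (hsm k)
  have hU : IntegrableOn (fun ω => x (N ω)) (⋃ k, s k) P := by
    refine integrableOn_iUnion_of_summable_integral_norm hon ?_
    simpa only [Real.norm_eq_abs, hval fun k => |x k|] using hx
  have h := hasSum_integral_iUnion hsm hsd hU
  simp only [hval x] at h
  rw [hsu] at h hU
  rw [Measure.restrict_univ] at h
  exact ⟨integrableOn_univ.1 hU, h⟩

theorem mainTheorem7 (γ μ ρ φ lam : ℝ) (hlam : 0 < lam) (hφ : 0 < φ) (hγ : 0 ≤ γ)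
    (hρ : 0 < ρ) (hρ1 : ρ ≤ 1) (hμ : 0 < μ) (hμ1 : μ ≤ 1)
    (hpar : γ ≠ 0 → ∀ r : ℕ, r ≤ ⌈γ⌉₊ →
      0 < μ * (⌈γ⌉₊ : ℝ) / γ - r * ρ ∧ μ * (⌈γ⌉₊ : ℝ) / γ - r * ρ < 1) :
    -- the series `G(v, ·)` converges and is the unique solution of its Cauchy problem
    (∀ v : ℝ, |v| ≤ 1 →
      (∀ t : ℝ, 0 ≤ t → Summable (pgfTerm γ μ ρ φ lam v t)) ∧
      IsCauchySolution γ μ ρ (-φ) (pgfSeries γ μ ρ φ lam v) 1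
        (fun t => -lam * (1 - v) * pgfSeries γ μ ρ φ lam v t) ∧
      (∀ f : ℝ → ℝ,
        IsCauchySolutionAE γ μ ρ (-φ) f 1 (fun t => -lam * (1 - v) * f t) →
        ∀ t : ℝ, 0 ≤ t → f t = pgfSeries γ μ ρ φ lam v t)) ∧
    -- the series for the state probabilities converge and solve the state system
    (∀ (k : ℕ) (t : ℝ), 0 ≤ t →
      Summable (fun r : Set.Ici k => stateTerm γ μ ρ φ lam k t r)) ∧
    SolvesStateSystem γ μ ρ φ lam (stateSeries γ μ ρ φ lam) ∧
    -- for every solution of the state system: generating function, explicit form, mean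
    (∀ p : ℕ → ℝ → ℝ, SolvesStateSystemAE γ μ ρ φ lam p →
      (∀ v : ℝ, |v| ≤ 1 →
        IsCauchySolution γ μ ρ (-φ) (fun t => ∑' k : ℕ, v ^ k * p k t) 1
          (fun t => -lam * (1 - v) * ∑' k : ℕ, v ^ k * p k t) ∧
        ∀ t : ℝ, 0 ≤ t → HasSum (fun k : ℕ => v ^ k * p k t) (pgfSeries γ μ ρ φ lam v t)) ∧
      (∀ (k : ℕ) (t : ℝ), 0 ≤ t → p k t = stateSeries γ μ ρ φ lam k t) ∧
      (∀ t : ℝ, 0 ≤ t → HasSum (fun k : ℕ => (k : ℝ) * p k t) (meanFormula γ μ ρ φ lam t))) ∧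
    -- for every counting process whose state probabilities solve the state system
    (∀ {Ω : Type*} [MeasurableSpace Ω] (P : Measure Ω) [IsProbabilityMeasure P]
      (N : ℝ → Ω → ℕ), (∀ t : ℝ, 0 ≤ t → Measurable (N t)) →
      SolvesStateSystemAE γ μ ρ φ lam (fun k t => P.real {ω | N t ω = k}) →
      (∀ v : ℝ, |v| ≤ 1 →
        IsCauchySolution γ μ ρ (-φ) (fun t => ∫ ω, v ^ N t ω ∂P) 1
          (fun t => -lam * (1 - v) * ∫ ω, v ^ N t ω ∂P) ∧
        ∀ t : ℝ, 0 ≤ t → ∫ ω, v ^ N t ω ∂P = pgfSeries γ μ ρ φ lam v t) ∧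
      (∀ (k : ℕ) (t : ℝ), 0 ≤ t →
        P.real {ω | N t ω = k} = stateSeries γ μ ρ φ lam k t) ∧
      (∀ t : ℝ, 0 ≤ t → Integrable (fun ω => (N t ω : ℝ)) P ∧
        ∫ ω, (N t ω : ℝ) ∂P = meanFormula γ μ ρ φ lam t)) := by

  -- The condition at `r = 0` gives `μ⌈γ⌉ < γ ≤ ⌈γ⌉`.
  have hγμ : γ ≠ 0 → μ < 1 := fun h0 => by
    have hγ' : 0 < γ := lt_of_le_of_ne hγ (Ne.symm h0)
    have h1 := (hpar h0 0 (Nat.zero_le _)).2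
    rw [Nat.cast_zero, zero_mul, sub_zero, div_lt_one hγ'] at h1
    have h2 := mul_le_mul_of_nonneg_left (Nat.le_ceil γ) hμ.le
    by_contra h3
    nlinarith [not_lt.1 h3]
  have hgen : ∀ p : ℕ → ℝ → ℝ, (∀ k t, 0 ≤ t → p k t = stateSeries γ μ ρ φ lam k t) →
      ∀ v : ℝ, |v| ≤ 1 → ∀ t : ℝ, 0 ≤ t →
        HasSum (fun k : ℕ => v ^ k * p k t) (pgfSeries γ μ ρ φ lam v t) := by
    intro p hp v hv t ht
    simpa only [fun k => hp k t ht] using hasSum_pow_mul_stateSeries hρ hμ φ hlam hv ht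
  have hmean : ∀ p : ℕ → ℝ → ℝ, (∀ k t, 0 ≤ t → p k t = stateSeries γ μ ρ φ lam k t) →
      ∀ t : ℝ, 0 ≤ t → HasSum (fun k : ℕ => (k : ℝ) * p k t) (meanFormula γ μ ρ φ lam t) := by
    intro p hp t ht
    simpa only [fun k => hp k t ht] using hasSum_natCast_mul_stateSeries hρ hμ φ hlam ht
  have hcongr : ∀ (v : ℝ) (f : ℝ → ℝ), (∀ t, 0 ≤ t → f t = pgfSeries γ μ ρ φ lam v t) →
      IsCauchySolution γ μ ρ (-φ) f 1 (fun t => -lam * (1 - v) * f t) := by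
    intro v f hf
    have hG := isCauchySolution_pgfSeries hγ hρ hμ hμ1 hγμ φ lam v
    exact hG.congr hρ hμ hμ1 hγμ (fun b hb => (hG.absCont b hb).const_mul _)
      (fun t ht => (hf t ht).symm) fun t ht => by rw [hf t ht]
  refine ⟨fun v _ => ⟨fun t ht => ?_, isCauchySolution_pgfSeries hγ hρ hμ hμ1 hγμ φ lam v,
    fun f hf t ht => eq_pgfSeries_of_isCauchySolutionAE hγ hρ hμ hμ1 hγμ φ lam v hf ht⟩,
    fun k t ht => ?_, solvesStateSystem_stateSeries hγ hρ hμ hμ1 hγμ φ hlam, fun p hp => ?_, ?_⟩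
  · simp only [funext (pgfTerm_eq (γ := γ) (ρ := ρ) (μ := μ) φ lam v ht)]
    exact summable_mul_prabhakarPower hρ hμ (abs_pow_le_one_mul (-lam * (1 - v))) (by positivity)
      γ (-φ) ht
  · have h := summable_mul_prabhakarPower hρ hμ (abs_stateCoeff_le hlam k) (by positivity)
      γ (-φ) ht
    simp only [← stateTerm_eq φ lam k ht] at h
    exact h.subtype _
  · have hpS := eq_stateSeries_of_solvesStateSystemAE hγ hρ hμ hμ1 hγμ φ hlam hp
    exact ⟨fun v hv => ⟨hcongr v _ fun t ht => (hgen p hpS v hv t ht).tsum_eq, hgen p hpS v hv⟩,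
      hpS, hmean p hpS⟩
  · intro Ω _ P _ N hN hp
    have hpS := eq_stateSeries_of_solvesStateSystemAE hγ hρ hμ hμ1 hγμ φ hlam hp
    have hpgf : ∀ v : ℝ, |v| ≤ 1 → ∀ t : ℝ, 0 ≤ t →
        ∫ ω, v ^ N t ω ∂P = pgfSeries γ μ ρ φ lam v t := fun v hv t ht => by
      refine (integrable_and_hasSum_integral_comp_nat P (hN t ht) (x := fun k => v ^ k)
        ?_).2.unique (hgen _ hpS v hv t ht)
      -- Probabilities are nonnegative, so absolute summability at `v` is summability of the
      -- generating function at `|v|`.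
      simpa only [abs_pow] using (hgen _ hpS |v| (by rwa [abs_abs]) t ht).summable
    refine ⟨fun v hv => ⟨hcongr v _ (hpgf v hv), hpgf v hv⟩, hpS, fun t ht => ?_⟩
    have h := integrable_and_hasSum_integral_comp_nat P (hN t ht) (x := fun k => (k : ℝ))
      (by simpa only [Nat.abs_cast] using (hmean _ hpS t ht).summable)
    exact ⟨h.1, h.2.unique (hmean _ hpS t ht)⟩
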